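/- Let $B$ be a real separable Banach space and let $L=\{L_t\}_{t\ge 0}$ be a $B$-valued Lévy process on a probability space $(\Omega,\mathcal F,\mathbb P)$ (independent and stationary increments, stochastically continuous, almost surely càdlàg paths, $L_0=0$ a.s.), where $\mathcal F=\sigma\{L_t: t\ge 0\}$. Let $\mathcal N$ be the $\mathbb P$-null sets of $\mathcal F$ and, with $L_{u,v}=L_v-L_u$, put $\mathcal F_t=\sigma\{L_u: u\le t\}\vee\mathcal N$ and $\mathcal F_{s,t}=\sigma\{L_{u,v}: s\le u\le v\le t\}\vee\mathcal N$. (1) For all $s,t\ge 0$ the shift of cylindrical functions $$\tau(L_{t_0,t_1},\dots,L_{t_{n-1},t_n})\longmapsto \tau(L_{s+t_0,s+t_1},\dots,L_{s+t_{n-1},s+t_n}),\qquad 0=t_0\le t_1\le\dots\le t_n=t,\ \tau:B^n\to\mathbb C \text{ bounded measurable},$$ extends uniquely to a unitary $S_{s,t}:L^2(\Omega,\mathcal F_t,\mathbb P)\to L^2(\Omega,\mathcal F_{s,s+t},\mathbb P)$. If $\sigma_s:\Omega\to\Omega$ is measure preserving and for each $t\ge0$ satisfies $L_t\circ\sigma_s=L_{s+t}-L_s$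 a.s., then $S_{s,t}g=g\circ\sigma_s$ for all $t\ge 0$ and $g\in L^2(\Omega,\mathcal F_t,\mathbb P)$. (2) There is a unique family of unitaries $$U_{s,t}:L^2(\Omega,\mathcal F_s,\mathbb P)\otimes L^2(\Omega,\mathcal F_t,\mathbb P)\to L^2(\Omega,\mathcal F_{s+t},\mathbb P),\qquad U_{s,t}(f\otimes g)=f\cdot S_{s,t}g,\qquad s,t>0 .$$ It is associative: $U_{t_1,t_2+t_3}(\mathbf 1\otimes U_{t_2,t_3})=U_{t_1+t_2,t_3}(U_{t_1,t_2}\otimes\mathbf 1)$ for all $t_1,t_2,t_3>0$. (3) With the Borel structure inherited from $(0,\infty)\times L^2(\Omega,\mathcal F,\mathbb P)$, the bundle $E^L=\{(t,f): t>0,\ f\in L^2(\Omega,\mathcal F_t,\mathbb P)\}$ is a standard Borel space whose fibres are separable Hilbert spaces; the projection onto $(0,\infty)$, the vector space operations, the inner products and the multiplication $((s,f),(t,g))\mapsto (s+t,U_{s,t}(f\otimes g))$ are Borel, and on every fibre the induced structure is the Borel structure of the norm. (4) For every $\phi\in B^*$, the family $u^\phi(t)=\exp(i\langle\phi,L_t\rangle)$,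 $t>0$, is a unit: a non-zero Borel section of $E^L$ with $u^\phi(s+t)=U_{s,t}(u^\phi(s)\otimes u^\phi(t))$ for all $s,t>0$. (5) If $L$ is not deterministic (that is, for some $t$ the vector $L_t$ is not almost surely constant), then every fibre is infinite-dimensional and $E^L$ is isomorphic, as a measurable family of Hilbert spaces, to the trivial bundle $(0,\infty)\times\ell^2(\mathbb N)$. Hence $(E^L,U)$ is a product system of Hilbert spaces, and it is spatial, that is, it has a unit. -/

import Mathlib

open MeasureTheory ProbabilityTheory Filter Topology
open scoped NNReal ENNReal TensorProduct

noncomputable section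

/-! ### Banach space valued Lévy processes -/

/-- The random function `L` is a Lévy process under `P`. -/
structure IsLevyProcess {Ω B : Type*} [MeasurableSpace Ω] [NormedAddCommGroup B]
    [MeasurableSpace B] (L : ℝ≥0 → Ω → B) (P : Measure Ω) : Prop where
  measurable : ∀ t, Measurable (L t)
  indep_past : ∀ s t u : ℝ≥0, u ≤ t → IndepFun (fun ω => L (t + s) ω - L t ω) (L u) P
  stationary : ∀ s t : ℝ≥0, IdentDistrib (fun ω => L (t + s) ω - L t ω) (L s) P P
  indepIncrements : HasIndepIncrements L P
  stochContinuous : ∀ ε : ℝ, 0 < ε → ∀ s : ℝ≥0,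
    Tendsto (fun t : ℝ≥0 => P {ω | ε < ‖L (s + t) ω - L s ω‖}) (𝓝[>] 0) (𝓝 0)
  cadlag : ∀ᵐ ω ∂P, ∀ t : ℝ≥0,
    ContinuousWithinAt (fun u => L u ω) (Set.Ici t) t ∧
      ∃ l : B, Tendsto (fun u => L u ω) (𝓝[<] t) (𝓝 l)
  zero : ∀ᵐ ω ∂P, L 0 ω = 0

/-- The process is deterministic: each `L t` is almost surely equal to a constant vector. -/
def IsDeterministicProcess {Ω B : Type*} [MeasurableSpace Ω] (L : ℝ≥0 → Ω → B) (P : Measure Ω) : Prop :=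
  ∀ t, ∃ b : B, ∀ᵐ ω ∂P, L t ω = b

/-- `σ(L_t : t ≥ 0)`. -/
abbrev sigmaAll {Ω B : Type*} [MeasurableSpace B] (L : ℝ≥0 → Ω → B) : MeasurableSpace Ω :=
  ⨆ t : ℝ≥0, MeasurableSpace.comap (L t) inferInstance

/-- The σ-algebra generated by the null sets of the σ-algebra of `Ω`. -/
abbrev nullSigma {Ω : Type*} [MeasurableSpace Ω] (P : Measure Ω) : MeasurableSpace Ω :=
  MeasurableSpace.generateFrom {A | MeasurableSet A ∧ P A = 0}

/-- `F_t = σ(L_u : u ≤ t) ∨ N`. -/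
abbrev sigmaPast {Ω B : Type*} [MeasurableSpace Ω] [MeasurableSpace B] (L : ℝ≥0 → Ω → B)
    (P : Measure Ω) (t : ℝ≥0) : MeasurableSpace Ω :=
  (⨆ u : Set.Iic t, MeasurableSpace.comap (L u) inferInstance) ⊔ nullSigma P

/-- `F_{s,t} = σ(L_v - L_u : s ≤ u ≤ v ≤ t) ∨ N`. -/
abbrev sigmaIncr {Ω B : Type*} [MeasurableSpace Ω] [MeasurableSpace B] [Sub B] (L : ℝ≥0 → Ω → B)
    (P : Measure Ω) (s t : ℝ≥0) : MeasurableSpace Ω :=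
  (⨆ q : {q : ℝ≥0 × ℝ≥0 // s ≤ q.1 ∧ q.1 ≤ q.2 ∧ q.2 ≤ t},
    MeasurableSpace.comap (fun ω => L q.1.2 ω - L q.1.1 ω) inferInstance) ⊔ nullSigma P

/-- `L²(Ω, m, P)`, as a subspace of `L²(Ω, P)`, for a sub-σ-algebra `m`. -/
abbrev L2Sub {Ω : Type*} {mΩ : MeasurableSpace Ω} (P : @Measure Ω mΩ) (m : MeasurableSpace Ω) :
    Submodule ℂ (@Lp Ω ℂ mΩ _ 2 P) :=
  @lpMeas Ω ℂ ℂ _ _ _ m mΩ 2 P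

/-- The increments `(L_{r + p_{i+1}} - L_{r + p_i})_{i < n}`. -/
def increments {Ω B : Type*} [Sub B] (L : ℝ≥0 → Ω → B) (r : ℝ≥0) {n : ℕ} (p : Fin (n + 1) → ℝ≥0)
    (ω : Ω) : Fin n → B :=
  fun i => L (r + p i.succ) ω - L (r + p i.castSucc) ω

/-- Families of unitaries `L²(F_t) → L²(F_{s,s+t})`, `s, t ≥ 0`. -/
abbrev ShiftFamily {Ω B : Type*} [MeasurableSpace Ω] [MeasurableSpace B] [Sub B]
    (L : ℝ≥0 → Ω → B) (P : Measure Ω) : Type _ :=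
  ∀ s t : ℝ≥0, L2Sub P (sigmaPast L P t) ≃ₗᵢ[ℂ] L2Sub P (sigmaIncr L P s (s + t))

/-- The unitaries `S s t` extend the shift of cylindrical functions
`τ(L_{t₀,t₁}, …, L_{tₙ₋₁,tₙ}) ↦ τ(L_{s+t₀,s+t₁}, …, L_{s+tₙ₋₁,s+tₙ})`, for all
`0 = t₀ ≤ t₁ ≤ ⋯ ≤ tₙ = t` and all bounded measurable `τ : Bⁿ → ℂ`. -/
def IsShiftFamily {Ω B : Type*} [MeasurableSpace Ω] [MeasurableSpace B] [Sub B]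
    (L : ℝ≥0 → Ω → B) (P : Measure Ω) (S : ShiftFamily L P) : Prop :=
  ∀ (s t : ℝ≥0) (n : ℕ) (p : Fin (n + 1) → ℝ≥0), Monotone p → p 0 = 0 → p (Fin.last n) = t →
    ∀ τ : (Fin n → B) → ℂ, Measurable τ → (∃ C : ℝ, ∀ x, ‖τ x‖ ≤ C) →
      ∀ f : L2Sub P (sigmaPast L P t),
        ((f : Lp ℂ 2 P) : Ω → ℂ) =ᵐ[P] (fun ω => τ (increments L 0 p ω)) →
        ((S s t f : Lp ℂ 2 P) : Ω → ℂ) =ᵐ[P] (fun ω => τ (increments L s p ω))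

/-! ### Product systems of Hilbert spaces -/

/-- The time set `(0, ∞)`. -/
abbrev PosTime : Type := {t : ℝ≥0 // 0 < t}

/-- The Hilbert space tensor product. -/
abbrev HilbertTensor (H K : Type*) [NormedAddCommGroup H] [InnerProductSpace ℂ H]
    [NormedAddCommGroup K] [InnerProductSpace ℂ K] : Type _ :=
  UniformSpace.Completion (H ⊗[ℂ] K)

/-- The elementary tensor `x ⊗ y` in the Hilbert space tensor product. -/
def pureTensor {H K : Type*} [NormedAddCommGroup H] [InnerProductSpace ℂ H]
    [NormedAddCommGroup K] [InnerProductSpace ℂ K] (x : H) (y : K) : HilbertTensor H K :=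
  ((x ⊗ₜ[ℂ] y : H ⊗[ℂ] K) : UniformSpace.Completion (H ⊗[ℂ] K))

/-- The Hilbert space `ℓ²(ℕ)`, with its Borel structure. -/
abbrev Ell2 : Type := lp (fun _ : ℕ => ℂ) 2

instance : MeasurableSpace Ell2 := borel Ell2
instance : BorelSpace Ell2 := ⟨rfl⟩

/-- The total space `{(t, x) | x ∈ E(t), t > 0}` of a bundle over `(0, ∞)`. -/
@[ext] structure TotalSpace (E : PosTime → Type*) where
  time : PosTime
  vec : E time

/-- The fibre product `{(t, x, y) | x, y ∈ E(t), t > 0}`. -/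
@[ext] structure FibrePairs (E : PosTime → Type*) where
  time : PosTime
  left : E time
  right : E time

/-- The fibre product carries the Borel structure of a subset of the square of the total space. -/
instance (E : PosTime → Type*) [MeasurableSpace (TotalSpace E)] : MeasurableSpace (FibrePairs E) :=
  MeasurableSpace.comap
    (fun q => ((⟨q.time, q.left⟩, ⟨q.time, q.right⟩) : TotalSpace E × TotalSpace E)) inferInstance

section ProductSystem

variable {E : PosTime → Type*} [∀ t, NormedAddCommGroup (E t)] [∀ t, InnerProductSpace ℂ (E t)]

/-- The multiplication `(s, x) (t, y) = (s + t, U_{s,t}(x ⊗ y))` on the total space. -/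
def bundleMul (U : ∀ s t : PosTime, HilbertTensor (E s) (E t) ≃ₗᵢ[ℂ] E (s + t))
    (a b : TotalSpace E) : TotalSpace E :=
  ⟨a.time + b.time, U a.time b.time (pureTensor a.vec b.vec)⟩

/-- A standard Borel bundle of separable Hilbert spaces over `(0, ∞)` with a measurable
associative family of unitaries `U_{s,t} : E(s) ⊗ E(t) → E(s + t)`. All operators in the
associativity relation being bounded and linear, it is stated on elementary tensors. -/
structure IsMultiplicativeBundle [MeasurableSpace (TotalSpace E)]
    (U : ∀ s t : PosTime, HilbertTensor (E s) (E t) ≃ₗᵢ[ℂ] E (s + t)) : Prop where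
  complete : ∀ t, CompleteSpace (E t)
  separable : ∀ t, TopologicalSpace.SeparableSpace (E t)
  standardBorel : StandardBorelSpace (TotalSpace E)
  measurable_time : Measurable (TotalSpace.time : TotalSpace E → PosTime)
  /-- On each fibre the structure induced by the total space is the Borel structure of the norm. -/
  fibre_embedding : ∀ t, @MeasurableEmbedding (E t) (TotalSpace E) (borel (E t)) _ (TotalSpace.mk t)
  measurable_smul : Measurable (fun q : ℂ × TotalSpace E =>
    (⟨q.2.time, q.1 • q.2.vec⟩ : TotalSpace E))
  measurable_add : Measurable (fun q : FibrePairs E =>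
    (⟨q.time, q.left + q.right⟩ : TotalSpace E))
  measurable_inner : Measurable (fun q : FibrePairs E => inner ℂ q.left q.right)
  measurable_mul : Measurable (fun q : TotalSpace E × TotalSpace E => bundleMul U q.1 q.2)
  assoc : ∀ a b c : TotalSpace E,
    bundleMul U a (bundleMul U b c) = bundleMul U (bundleMul U a b) c

/-- Product systems: multiplicative bundles with infinite-dimensional fibres which are isomorphic,
as measurable families of Hilbert spaces, to the trivial bundle `(0, ∞) × ℓ²(ℕ)`. -/
structure IsProductSystem [MeasurableSpace (TotalSpace E)]
    (U : ∀ s t : PosTime, HilbertTensor (E s) (E t) ≃ₗᵢ[ℂ] E (s + t)) : Prop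
    extends IsMultiplicativeBundle U where
  infinite_dim : ∀ t, ¬ FiniteDimensional ℂ (E t)
  trivializable : ∃ (V : ∀ t, E t ≃ₗᵢ[ℂ] Ell2) (Φ : TotalSpace E ≃ᵐ PosTime × Ell2),
    ∀ x : TotalSpace E, Φ x = (x.time, V x.time x.vec)

/-- Units: non-zero Borel sections with `u(s + t) = u(s) u(t)`. -/
structure IsProductUnit [MeasurableSpace (TotalSpace E)]
    (U : ∀ s t : PosTime, HilbertTensor (E s) (E t) ≃ₗᵢ[ℂ] E (s + t)) (u : ∀ t, E t) : Prop where
  measurable : Measurable (fun t => (⟨t, u t⟩ : TotalSpace E))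
  ne_zero : ∃ t, u t ≠ 0
  mul : ∀ s t : PosTime, u (s + t) = U s t (pureTensor (u s) (u t))

/-- Spatial product systems: those that have a unit. -/
structure IsSpatialProductSystem [MeasurableSpace (TotalSpace E)]
    (U : ∀ s t : PosTime, HilbertTensor (E s) (E t) ≃ₗᵢ[ℂ] E (s + t)) : Prop
    extends IsProductSystem U where
  exists_unit : ∃ u : ∀ t, E t, IsProductUnit U u

end ProductSystem

/-! ### The bundle of a Lévy process -/

section LevyBundle

variable {Ω B : Type*} [MeasurableSpace Ω] [MeasurableSpace B]

instance (P : Measure Ω) : MeasurableSpace (Lp ℂ 2 P) := borel _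
instance (P : Measure Ω) : BorelSpace (Lp ℂ 2 P) := ⟨rfl⟩

/-- The fibre `L²(Ω, F_t, P)`. -/
abbrev levyFibre (L : ℝ≥0 → Ω → B) (P : Measure Ω) (t : PosTime) : Type _ :=
  L2Sub P (sigmaPast L P t)

/-- The bundle carries the Borel structure of a subset of `(0, ∞) × L²(Ω, P)`. -/
instance (L : ℝ≥0 → Ω → B) (P : Measure Ω) : MeasurableSpace (TotalSpace (levyFibre L P)) :=
  MeasurableSpace.comap (fun x => ((x.time, (x.vec : Lp ℂ 2 P)) : PosTime × Lp ℂ 2 P)) inferInstance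

/-- `U_{s,t}(f ⊗ g) = f · S_{s,t} g`. -/
def IsLevyMultiplication [Sub B] (L : ℝ≥0 → Ω → B) (P : Measure Ω) (S : ShiftFamily L P)
    (U : ∀ s t : PosTime,
      HilbertTensor (levyFibre L P s) (levyFibre L P t) ≃ₗᵢ[ℂ] levyFibre L P (s + t)) : Prop :=
  ∀ (s t : PosTime) (f : levyFibre L P s) (g : levyFibre L P t),
    ((U s t (pureTensor f g) : Lp ℂ 2 P) : Ω → ℂ) =ᵐ[P]
      fun ω => ((f : Lp ℂ 2 P) : Ω → ℂ) ω * ((S s t g : Lp ℂ 2 P) : Ω → ℂ) ω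

end LevyBundle

end

/-! Everything is read off the laws of the restarted paths `incrPath L s T`, that is, `u ↦ L (s + u)
- L s`. Stationary independent increments make this law independent of `s` (`map_incrPath`). Pulling
back along the path from time `0` and along the path from time `s` therefore gives two isometries
out of one and the same `L²`-space. The first is onto, because the path generates the σ-algebra up
to null sets, and `shift` is the second composed with the inverse of the first. On a function of the
path the shift just substitutes the restarted path (`shift_ae_eq`).

The past up to `s` and the path restarted at `s` are independent (`indepFun_incrPath`), so `(f, g) ↦
f · S_s g` multiplies inner products (`inner_mulShift`). Its range is total because it contains the
indicators of a generating family of rectangles (`eq_top_of_mulFibre_mem`). It thus extends to a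
unitary of the Hilbert tensor product. Associativity says that the shifts form a multiplicative
semigroup.

For the Borel structure, the fibres increase with `t`, so `‖P_t x‖` is monotone in `t` and the
projections `P_t` are measurable in `t`. The bundle is then a Borel subset of a Polish product.
Right-continuity of paths makes the shift strongly continuous, which gives measurability of the
multiplication. It also gives separability and continuity of the exponential units.

In a finite-dimensional fibre, `dim E(t) ≥ (dim E(t/2))²` forces dimension at most one at some small
time `r`. Then `L u` is a.s. constant for `u ≤ r`, and doubling spreads this to all times. Otherwise
all fibres are infinite-dimensional, and Gram–Schmidt applied to the projections of a dense sequence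
trivializes the bundle. -/

/-! ### Closed subspaces of `L²` and π-systems -/

section Generation

variable {Ω : Type*} {m mΩ : MeasurableSpace Ω} {P : Measure Ω}

/-- Composition with a measurable map, as an isometry of `L²`-spaces. -/
noncomputable abbrev pullL2 (P : Measure Ω) {𝒴 : Type*} [MeasurableSpace 𝒴] {Q : Measure 𝒴}
    {Y : Ω → 𝒴} (hY : MeasurePreserving Y P Q) : Lp ℂ 2 Q →ₗᵢ[ℂ] Lp ℂ 2 P :=
  Lp.compMeasurePreservingₗᵢ ℂ Y hY

theorem pullL2_coeFn {𝒴 : Type*} [MeasurableSpace 𝒴] {Q : Measure 𝒴}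
    {Y : Ω → 𝒴} (hY : MeasurePreserving Y P Q) (g : Lp ℂ 2 Q) :
    (pullL2 P hY g : Ω → ℂ) =ᵐ[P] g ∘ Y :=
  Lp.coeFn_compMeasurePreserving g hY

theorem isClosed_range_linearIsometry {E F : Type*} [NormedAddCommGroup E] [NormedSpace ℂ E]
    [CompleteSpace E] [NormedAddCommGroup F] [NormedSpace ℂ F] (J : E →ₗᵢ[ℂ] F) :
    IsClosed (LinearMap.range J.toLinearMap : Set F) := by
  rw [LinearMap.coe_range]
  exact J.isometry.isClosedEmbedding.isClosed_range

theorem mem_L2Sub_of_ae_eq {f : Lp ℂ 2 P} {g : Ω → ℂ}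
    (hg : Measurable[m] g) (h : f =ᵐ[P] g) : f ∈ L2Sub P m :=
  mem_lpMeas_iff_aestronglyMeasurable.2 ⟨g, hg.stronglyMeasurable, h⟩

theorem isClosed_L2Sub (hm : m ≤ mΩ) :
    IsClosed (L2Sub P m : Set (Lp ℂ 2 P)) := by
  have : Fact (m ≤ mΩ) := ⟨hm⟩
  exact isClosed_aestronglyMeasurable hm

theorem nullSigma_le : nullSigma P ≤ mΩ := MeasurableSpace.generateFrom_le fun _ hA => hA.1

theorem nullSigma_le_eventuallyMeasurableSpace (m : MeasurableSpace Ω) {mΩ : MeasurableSpace Ω}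
    {P : Measure Ω} :
    nullSigma P ≤ eventuallyMeasurableSpace m (ae P) :=
  MeasurableSpace.generateFrom_le fun _ hA =>
    ⟨∅, @MeasurableSet.empty _ m, ae_eq_empty.2 hA.2⟩

/-- Null sets are handled through `eventuallyMeasurableSpace m (ae P)`, the sets a.e. equal to an
`m`-measurable one. A variable then needs to be identified only almost surely. -/
theorem comap_le_eventuallyMeasurableSpace {β : Type*} [mβ : MeasurableSpace β]
    {f g : Ω → β} (hg : Measurable[m] g) (hfg : f =ᵐ[P] g) :
    mβ.comap f ≤ eventuallyMeasurableSpace m (ae P) := by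
  rintro _ ⟨C, hC, rfl⟩
  refine ⟨g ⁻¹' C, hg hC, ?_⟩
  filter_upwards [hfg] with ω hω
  exact congrArg C (by exact hω)

variable [IsProbabilityMeasure P]

/-- The indicator function of a measurable set, as an element of `L²`. -/
noncomputable abbrev indL2 (P : Measure Ω) [IsProbabilityMeasure P] {A : Set Ω}
    (hA : MeasurableSet A) : Lp ℂ 2 P :=
  indicatorConstLp 2 hA (measure_ne_top P A) 1

theorem indL2_coeFn {A : Set Ω} (hA : MeasurableSet A) :
    (indL2 P hA : Ω → ℂ) =ᵐ[P] A.indicator fun _ => 1 :=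
  indicatorConstLp_coeFn

theorem indL2_congr {A A' : Set Ω} (hA : MeasurableSet A) (hA' : MeasurableSet A')
    (h : A =ᵐ[P] A') : indL2 P hA = indL2 P hA' := by
  refine Lp.ext ?_
  refine (indL2_coeFn hA).trans (EventuallyEq.trans ?_ (indL2_coeFn hA').symm)
  exact indicator_ae_eq_of_ae_eq_set h

/-- A π-λ argument: `univ ∈ 𝒞` puts the constant `1` in `V`, which gives complements, and closedness
of `V` gives countable disjoint unions as `L²`-limits of finite ones. -/
theorem indL2_mem_of_generateFrom {𝒴 : Type*} [m𝒴 : MeasurableSpace 𝒴] {Y : Ω → 𝒴}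
    (hY : Measurable Y) {𝒞 : Set (Set 𝒴)} (hpi : IsPiSystem 𝒞)
    (hgen : m𝒴 = MeasurableSpace.generateFrom 𝒞) (huniv : Set.univ ∈ 𝒞)
    {V : Submodule ℂ (Lp ℂ 2 P)} (hV : IsClosed (V : Set (Lp ℂ 2 P)))
    (h : ∀ C ∈ 𝒞, ∀ hC : MeasurableSet C, indL2 P (hY hC) ∈ V)
    {C : Set 𝒴} (hC : MeasurableSet C) : indL2 P (hY hC) ∈ V := by
  have hone : indL2 P (hY MeasurableSet.univ) ∈ V := h _ huniv MeasurableSet.univ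
  induction C, hC using MeasurableSpace.induction_on_inter hgen hpi with
  | empty =>
    convert V.zero_mem
    refine Lp.ext ((indL2_coeFn _).trans ?_)
    filter_upwards [Lp.coeFn_zero ℂ 2 P] with ω hω
    simp
  | basic C hC' => exact h C hC' (by rw [hgen]; exact MeasurableSpace.measurableSet_generateFrom hC')
  | compl C hC ih =>
    have : indL2 P (hY hC.compl) = indL2 P (hY MeasurableSet.univ) - indL2 P (hY hC) := by
      refine Lp.ext ((indL2_coeFn _).trans ?_)
      filter_upwards [Lp.coeFn_sub (indL2 P (hY MeasurableSet.univ)) (indL2 P (hY hC)),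
        indL2_coeFn (P := P) (hY MeasurableSet.univ), indL2_coeFn (P := P) (hY hC)] with ω h1 h2 h3
      rw [h1, Pi.sub_apply, h2, h3]
      by_cases hω : Y ω ∈ C <;> simp [hω]
    rw [this]
    exact V.sub_mem hone ih
  | iUnion f hd hf ih =>
    have hfin : ∀ n : ℕ, MeasurableSet (⋃ i ∈ Finset.range n, f i) := fun n =>
      Finset.measurableSet_biUnion _ fun i _ => hf i
    have hmem : ∀ n : ℕ, indL2 P (hY (hfin n)) ∈ V := by
      intro n
      have : indL2 P (hY (hfin n)) = ∑ i ∈ Finset.range n, indL2 P (hY (hf i)) := by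
        refine Lp.ext ((indL2_coeFn _).trans ?_)
        have hs := Lp.coeFn_finsetSum (p := 2) (μ := P) (Finset.range n) fun i => indL2 P (hY (hf i))
        filter_upwards [hs, ae_all_iff.2 fun i => indL2_coeFn (P := P) (hY (hf i))] with ω h1 h2
        rw [h1, Finset.sum_apply]
        simp_rw [h2]
        rw [Set.preimage_iUnion₂]
        exact Finset.indicator_biUnion_apply _ _ (fun i _ j _ hij => (hd hij).preimage Y) _
      rw [this]
      exact V.sum_mem fun i _ => ih i
    refine hV.mem_of_tendsto (b := atTop) ?_ (Eventually.of_forall hmem)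
    refine tendsto_indicatorConstLp_set (by norm_num) ?_
    have hmono : Antitone fun n : ℕ => symmDiff (Y ⁻¹' (⋃ i ∈ Finset.range n, f i)) (Y ⁻¹' ⋃ i, f i) := by
      intro n m hnm ω hω
      simp only [Set.mem_symmDiff, Set.mem_preimage, Set.mem_iUnion, Finset.mem_range,
        exists_prop, not_exists, not_and] at hω ⊢
      rcases hω with ⟨⟨i, hi, hi'⟩, h2⟩ | ⟨h1, h2⟩
      · exact absurd hi' (h2 i)
      · exact Or.inr ⟨h1, fun i hi => h2 i (hi.trans_le hnm)⟩
    have := tendsto_measure_iInter_atTop (μ := P)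
      (fun n => (((hY (hfin n)).symmDiff (hY (MeasurableSet.iUnion hf))).nullMeasurableSet))
      hmono ⟨0, measure_ne_top _ _⟩
    -- The symmetric differences decrease to the empty set.
    rwa [measure_mono_null (μ := P) (t := ∅) (fun ω hω => ?_) measure_empty] at this
    simp only [Set.mem_iInter, Set.mem_symmDiff, Set.mem_preimage, Set.mem_iUnion,
      Finset.mem_range, exists_prop, not_exists, not_and] at hω
    rcases hω 0 with ⟨⟨i, hi, -⟩, -⟩ | ⟨⟨i, hi⟩, -⟩
    · exact absurd hi (Nat.not_lt_zero i)
    · rcases hω (i + 1) with ⟨-, h2⟩ | ⟨-, h2⟩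
      · exact absurd hi (h2 i)
      · exact absurd hi (h2 i (Nat.lt_succ_self i))

/-- A closed subspace of `L²(P)` that contains the indicator functions of a π-system generating `m`
up to null sets contains `L²(m)`. -/
theorem L2Sub_le_of_generateFrom {𝒴 : Type*} [m𝒴 : MeasurableSpace 𝒴] {Y : Ω → 𝒴}
    (hY : Measurable Y) (hm : m ≤ mΩ)
    (hmY : m ≤ eventuallyMeasurableSpace (m𝒴.comap Y) (ae P))
    {𝒞 : Set (Set 𝒴)} (hpi : IsPiSystem 𝒞)
    (hgen : m𝒴 = MeasurableSpace.generateFrom 𝒞) (huniv : Set.univ ∈ 𝒞)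
    {V : Submodule ℂ (Lp ℂ 2 P)} (hV : IsClosed (V : Set (Lp ℂ 2 P)))
    (h : ∀ C ∈ 𝒞, ∀ hC : MeasurableSet C, indL2 P (hY hC) ∈ V) : L2Sub P m ≤ V := by
  intro f hf
  refine Lp.induction_stronglyMeasurable hm (by norm_num) (fun f => f ∈ V) ?_ ?_ ?_ f
    (mem_lpMeas_iff_aestronglyMeasurable.1 hf)
  · intro c A hA hPA
    -- Up to a null set, `A` is of the form `Y ⁻¹' C`, so both indicators are the same element of
    -- `L²`.
    obtain ⟨_, ⟨C, hC, rfl⟩, hAC⟩ := hmY A hA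
    have : (Lp.simpleFunc.indicatorConst 2 (hm A hA) hPA.ne c : Lp ℂ 2 P) = c • indL2 P (hY hC) := by
      refine Lp.ext ?_
      rw [Lp.simpleFunc.coe_indicatorConst]
      refine indicatorConstLp_coeFn.trans ?_
      filter_upwards [Lp.coeFn_smul c (indL2 P (hY hC)), indL2_coeFn (P := P) (hY hC),
        hAC.mem_iff] with ω h1 h2 h3
      rw [h1, Pi.smul_apply, h2]
      by_cases hω : ω ∈ A
      · simp [hω, h3.1 hω]
      · simp [hω, show Y ω ∉ C from fun hh => hω (h3.2 hh)]
    rw [this]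
    exact V.smul_mem c (indL2_mem_of_generateFrom hY hpi hgen huniv hV h hC)
  · intro f g hf hg _ _ _ h1 h2
    exact V.add_mem h1 h2
  · exact hV.preimage continuous_subtype_val

theorem L2Sub_le {𝒴 : Type*} [m𝒴 : MeasurableSpace 𝒴] {Y : Ω → 𝒴}
    (hY : Measurable Y) (hm : m ≤ mΩ)
    (hmY : m ≤ eventuallyMeasurableSpace (m𝒴.comap Y) (ae P))
    {V : Submodule ℂ (Lp ℂ 2 P)} (hV : IsClosed (V : Set (Lp ℂ 2 P)))
    (h : ∀ (C : Set 𝒴) (hC : MeasurableSet C), indL2 P (hY hC) ∈ V) : L2Sub P m ≤ V :=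
  L2Sub_le_of_generateFrom hY hm hmY MeasurableSpace.isPiSystem_measurableSet
    MeasurableSpace.generateFrom_measurableSet.symm MeasurableSet.univ hV fun _ _ hC => h _ hC

theorem pullL2_indL2 {𝒴 : Type*} [MeasurableSpace 𝒴] {Q : Measure 𝒴} [IsProbabilityMeasure Q]
    {Y : Ω → 𝒴} (hY : MeasurePreserving Y P Q) {C : Set 𝒴} (hC : MeasurableSet C) :
    pullL2 P hY (indL2 Q hC) = indL2 P (hY.measurable hC) := by
  refine Lp.ext ((pullL2_coeFn hY _).trans (EventuallyEq.trans ?_ (indL2_coeFn _).symm))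
  exact hY.quasiMeasurePreserving.ae_eq_comp (indL2_coeFn hC)

/-- The range of an isometry on a complete space is closed, and it contains the indicators of all
sets `Y ⁻¹' C`. -/
theorem L2Sub_le_range_pullL2 {𝒴 : Type*} [m𝒴 : MeasurableSpace 𝒴] {Q : Measure 𝒴}
    [IsProbabilityMeasure Q] {Y : Ω → 𝒴}
    (hY : MeasurePreserving Y P Q) (hm : m ≤ mΩ)
    (hmY : m ≤ eventuallyMeasurableSpace (m𝒴.comap Y) (ae P)) :
    L2Sub P m ≤ LinearMap.range (pullL2 P hY).toLinearMap :=
  L2Sub_le hY.measurable hm hmY (isClosed_range_linearIsometry _) fun _ hC =>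
    ⟨indL2 Q hC, pullL2_indL2 hY hC⟩

/-- Elements of `L²(σ(Y))` are functions of `Y`. -/
theorem exists_measurable_comp_of_mem_L2Sub {𝒴 : Type*} [m𝒴 : MeasurableSpace 𝒴] {Y : Ω → 𝒴}
    (hY : Measurable Y) (hm : m ≤ mΩ)
    (hmY : m ≤ eventuallyMeasurableSpace (m𝒴.comap Y) (ae P)) {f : Lp ℂ 2 P} (hf : f ∈ L2Sub P m) :
    ∃ h : 𝒴 → ℂ, Measurable h ∧ f =ᵐ[P] h ∘ Y := by
  have : IsProbabilityMeasure (P.map Y) := Measure.isProbabilityMeasure_map hY.aemeasurable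
  obtain ⟨g, rfl⟩ := L2Sub_le_range_pullL2 (hY.measurePreserving P) hm hmY hf
  exact ⟨g, (Lp.stronglyMeasurable g).measurable, pullL2_coeFn _ g⟩

theorem indL2_mem_L2Sub {A : Set Ω} (hA : MeasurableSet A)
    (hA' : MeasurableSet[m] A) : indL2 P hA ∈ L2Sub P m :=
  mem_L2Sub_of_ae_eq (measurable_const.indicator hA') (indL2_coeFn hA)

end Generation

/-! ### Increments of a Lévy process -/

section Paths

set_option linter.unusedSectionVars false

variable {Ω B : Type*} [NormedAddCommGroup B] [CompleteSpace B] [SecondCountableTopology B]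
  [MeasurableSpace B] [BorelSpace B]

/-- The path `u ↦ L (s + u) - L s` of the process restarted at time `s`, for `u ∈ T`. -/
def incrPath (L : ℝ≥0 → Ω → B) (s : ℝ≥0) (T : Set ℝ≥0) (ω : Ω) : T → B :=
  fun u => L (s + u) ω - L s ω

/-- The σ-algebra generated by the path of the restarted process. -/
abbrev pathSigma (L : ℝ≥0 → Ω → B) (s : ℝ≥0) (T : Set ℝ≥0) : MeasurableSpace Ω :=
  MeasurableSpace.comap (incrPath L s T) MeasurableSpace.pi

theorem measurable_pathSigma_apply (L : ℝ≥0 → Ω → B) (s : ℝ≥0) {T : Set ℝ≥0} {u : ℝ≥0}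
    (hu : u ∈ T) : Measurable[pathSigma L s T] fun ω => L (s + u) ω - L s ω :=
  (measurable_pi_apply (⟨u, hu⟩ : T)).comp (comap_measurable (incrPath L s T))

/-- The increments telescope. The function `φ` is chosen before `L`, `p` and `r`, so one and the
same function serves the original and the shifted path. -/
theorem exists_increments_eq (k n : ℕ) (hk : k < n + 1) :
    ∃ φ : (Fin n → B) → B, Measurable φ ∧
      ∀ (L : ℝ≥0 → Ω → B) (p : Fin (n + 1) → ℝ≥0) (r : ℝ≥0) (ω : Ω),
        L (r + p ⟨k, hk⟩) ω - L (r + p 0) ω = φ (increments L r p ω) := by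
  induction k with
  | zero => exact ⟨fun _ => 0, measurable_const, fun L p r ω => by simp⟩
  | succ k ih =>
    obtain ⟨φ, hφ, h⟩ := ih (by omega)
    refine ⟨fun x => φ x + x ⟨k, by omega⟩, hφ.add (measurable_pi_apply _), fun L p r ω => ?_⟩
    have := h L p r ω
    simp only [← this]
    simp [increments]

/-- The values of the path at finitely many times are a function of the increments over a
partition. -/
theorem exists_incrPath_eq_increments (t : ℝ≥0) (I : Finset ℝ≥0) (hI : ∀ u ∈ I, u ≤ t) :
    ∃ (n : ℕ) (p : Fin (n + 1) → ℝ≥0), Monotone p ∧ p 0 = 0 ∧ p (Fin.last n) = t ∧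
      ∃ φ : (Fin n → B) → I → B, Measurable φ ∧
        ∀ (L : ℝ≥0 → Ω → B) (r : ℝ≥0) (ω : Ω),
          (fun u : I => L (r + u) ω - L r ω) = φ (increments L r p ω) := by
  classical
  set K : Finset ℝ≥0 := insert 0 (insert t I) with hK
  obtain ⟨n, hn⟩ : ∃ n, K.card = n + 1 :=
    Nat.exists_eq_succ_of_ne_zero (Finset.card_ne_zero_of_mem (Finset.mem_insert_self 0 _))
  have hp0 : K.orderEmbOfFin hn 0 = 0 := by
    obtain ⟨i, hi⟩ : (0 : ℝ≥0) ∈ Set.range (K.orderEmbOfFin hn) := by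
      rw [Finset.range_orderEmbOfFin]; simp [hK]
    refine le_antisymm ?_ zero_le
    rw [← hi]
    exact (K.orderEmbOfFin hn).monotone (Fin.zero_le i)
  have hpt : K.orderEmbOfFin hn (Fin.last n) = t := by
    obtain ⟨i, hi⟩ : t ∈ Set.range (K.orderEmbOfFin hn) := by
      rw [Finset.range_orderEmbOfFin]; simp [hK]
    refine le_antisymm ?_ ?_
    · have := Finset.orderEmbOfFin_mem K hn (Fin.last n)
      rcases (by simpa only [hK, Finset.mem_insert] using this :
        K.orderEmbOfFin hn (Fin.last n) = 0 ∨ K.orderEmbOfFin hn (Fin.last n) = t ∨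
          K.orderEmbOfFin hn (Fin.last n) ∈ I) with h | h | h
      · exact h.le.trans zero_le
      · exact h.le
      · exact hI _ h
    · rw [← hi]
      exact (K.orderEmbOfFin hn).monotone (Fin.le_last i)
  have hex : ∀ u : I, ∃ i, K.orderEmbOfFin hn i = u := by
    intro u
    have : (u : ℝ≥0) ∈ Set.range (K.orderEmbOfFin hn) := by
      rw [Finset.range_orderEmbOfFin]; simp [hK]
    exact this
  choose k hk using hex
  choose φ hφ h using fun u : I => exists_increments_eq (Ω := Ω) (B := B) (k u) n (k u).2
  refine ⟨n, K.orderEmbOfFin hn, (K.orderEmbOfFin hn).monotone, hp0, hpt,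
    fun x u => φ u x, measurable_pi_lambda _ hφ, fun L r ω => funext fun u => ?_⟩
  change _ = φ u (increments L r _ ω)
  rw [← h, hp0, Fin.eta, hk, add_zero]

variable [mΩ : MeasurableSpace Ω] {P : Measure Ω} [IsProbabilityMeasure P] {L : ℝ≥0 → Ω → B}

/-! ### Stationarity and independence of restarted paths. -/

namespace IsLevyProcess

theorem measurable_incrPath (hL : IsLevyProcess L P) (s : ℝ≥0) (T : Set ℝ≥0) :
    Measurable (incrPath L s T) :=
  measurable_pi_lambda _ fun _ => (hL.measurable _).sub (hL.measurable _)

/-- Single increments agree in law by stationarity, and both families are independent, so the joint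
laws agree. -/
theorem identDistrib_increments (hL : IsLevyProcess L P) (s : ℝ≥0) {n : ℕ}
    {p : Fin (n + 1) → ℝ≥0} (hp : Monotone p) :
    IdentDistrib (increments L s p) (increments L 0 p) P P := by
  have key : ∀ (r : ℝ≥0) (i : Fin n), IdentDistrib
      (fun ω => L (r + p i.succ) ω - L (r + p i.castSucc) ω) (L (p i.succ - p i.castSucc)) P P := by
    intro r i
    have := hL.stationary (p i.succ - p i.castSucc) (r + p i.castSucc)
    rwa [add_assoc, add_tsub_cancel_of_le (hp i.castSucc_lt_succ.le)] at this
  have hind : ∀ r : ℝ≥0, iIndepFun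
      (fun (i : Fin n) ω => L (r + p i.succ) ω - L (r + p i.castSucc) ω) P := fun r =>
    hL.indepIncrements n (fun i => r + p i) fun i j hij => by simpa using hp hij
  exact IdentDistrib.pi (fun i => (key s i).trans (key 0 i).symm) (hind s) (hind 0)

/-- A law on a product space is determined by its finite-dimensional marginals, and these are images
of laws of increments under a map that does not depend on the starting time. -/
theorem map_incrPath (hL : IsLevyProcess L P) (s : ℝ≥0) (T : Set ℝ≥0) :
    P.map (incrPath L s T) = P.map (incrPath L 0 T) := by
  classical
  refine (map_eq_iff_forall_finset_map_restrict_eq (hL.measurable_incrPath s T).aemeasurable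
    (hL.measurable_incrPath 0 T).aemeasurable).2 fun I => ?_
  set I' : Finset ℝ≥0 := I.image (↑) with hI'
  obtain ⟨n, p, hp, -, -, φ, hφ, h⟩ := exists_incrPath_eq_increments (Ω := Ω) (B := B)
    (I'.sup id) I' fun u hu => Finset.le_sup (f := id) hu
  set e : I → I' := fun u => ⟨u, Finset.mem_image_of_mem _ u.2⟩ with he
  have hr : ∀ r ω, I.restrict (incrPath L r T ω) = fun u => φ (increments L r p ω) (e u) := by
    intro r ω
    rw [← h]
    rfl
  have hm : Measurable fun (x : Fin n → B) (u : I) => φ x (e u) :=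
    measurable_pi_lambda _ fun u => (measurable_pi_apply _).comp hφ
  have := ((hL.identDistrib_increments s hp).comp hm).map_eq
  change P.map (fun ω => I.restrict (incrPath L s T ω)) =
    P.map (fun ω => I.restrict (incrPath L 0 T ω))
  simp_rw [hr]
  exact this

theorem measurePreserving_incrPath (hL : IsLevyProcess L P) (s : ℝ≥0) (T : Set ℝ≥0) :
    MeasurePreserving (incrPath L s T) P (P.map (incrPath L 0 T)) :=
  ⟨hL.measurable_incrPath s T, hL.map_incrPath s T⟩

theorem indepFun_increments (hL : IsLevyProcess L P) {n m : ℕ}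
    {p : Fin (n + 1) → ℝ≥0} (hp : Monotone p) {q : Fin (m + 1) → ℝ≥0} (hq : Monotone q)
    (hq0 : q 0 = 0) :
    IndepFun (increments L 0 p) (increments L (p (Fin.last n)) q) P := by
  classical
  set s := p (Fin.last n) with hs
  -- The partition `p` is followed by `s + q`, then made constant from index `n + m` on. Since `q 0
  -- = 0`, the two pieces agree at index `n`, and the two vectors of increments occupy disjoint
  -- blocks of indices.
  set r : ℕ → ℝ≥0 := fun k => if h : k < n + 1 then p ⟨k, h⟩ else
    s + q ⟨min (k - n) m, by omega⟩ with hr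
  have hrp : ∀ k, ∀ hk : k < n + 1, r k = p ⟨k, hk⟩ := fun k hk => dif_pos hk
  have hrq : ∀ k, ∀ hk : k < m + 1, r (n + k) = s + q ⟨k, hk⟩ := by
    intro k hk
    rcases Nat.eq_zero_or_pos k with rfl | hk0
    · rw [hrp _ (by omega)]
      change p (Fin.last n) = s + q 0
      rw [hq0, add_zero]
    · simp only [hr]
      rw [dif_neg (by omega)]
      congr 3
      omega
  have hmono : Monotone r := by
    intro a b hab
    simp only [hr]
    split_ifs with h1 h2 h2
    · exact hp hab
    · exact (hp (Fin.le_last _)).trans (le_add_of_nonneg_right zero_le)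
    · omega
    · gcongr
      exact hq (by simp only [Fin.mk_le_mk]; omega)
  have hind := (hL.indepIncrements.nat hmono).indepFun_finset (Finset.range n)
    (Finset.Ico n (n + m)) (Finset.disjoint_left.2 fun k hk hk' => by
      simp only [Finset.mem_range, Finset.mem_Ico] at hk hk'; omega)
    fun k => (hL.measurable _).sub (hL.measurable _)
  have hφ : Measurable fun (x : Finset.range n → B) (i : Fin n) =>
      x ⟨i, Finset.mem_range.2 i.2⟩ := measurable_pi_lambda _ fun i => measurable_pi_apply _
  have hψ : Measurable fun (x : Finset.Ico n (n + m) → B) (j : Fin m) =>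
      x ⟨n + j, Finset.mem_Ico.2 ⟨by omega, by omega⟩⟩ :=
    measurable_pi_lambda _ fun i => measurable_pi_apply _
  convert hind.comp hφ hψ using 1
  · funext ω i
    simp only [increments, Function.comp_apply, zero_add]
    rw [hrp _ (by omega), hrp _ (by omega)]
    rfl
  · funext ω j
    simp only [increments, Function.comp_apply]
    rw [add_assoc, hrq _ (by omega), hrq _ (by omega)]
    rfl

/-- The past of the process up to time `s` and the restarted process are independent. -/
theorem indepFun_incrPath (hL : IsLevyProcess L P) (s : ℝ≥0) (T : Set ℝ≥0) :
    IndepFun (incrPath L 0 (Set.Iic s)) (incrPath L s T) P := by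
  classical
  -- Independence of the two processes is checked on finitely many times of each.
  refine IndepFun.process_indepFun_process (X := fun u ω => incrPath L 0 (Set.Iic s) ω u)
    (Y := fun u ω => incrPath L s T ω u)
    (fun u => (measurable_pi_apply u).comp (hL.measurable_incrPath 0 _))
    (fun u => (measurable_pi_apply u).comp (hL.measurable_incrPath s _)) fun I J => ?_
  set I' : Finset ℝ≥0 := I.image (↑) with hI'
  set J' : Finset ℝ≥0 := J.image (↑) with hJ'
  obtain ⟨n, p, hp, hp0, hps, φ, hφ, h⟩ := exists_incrPath_eq_increments (Ω := Ω) (B := B)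
    s I' fun u hu => by
      obtain ⟨v, -, rfl⟩ := Finset.mem_image.1 hu
      exact v.2
  obtain ⟨m, q, hq, hq0, -, ψ, hψ, h'⟩ := exists_incrPath_eq_increments (Ω := Ω) (B := B)
    (J'.sup id) J' fun u hu => Finset.le_sup (f := id) hu
  have hind := hL.indepFun_increments hp hq hq0
  rw [hps] at hind
  have hm : Measurable fun (x : Fin n → B) (u : I) =>
      φ x ⟨u, Finset.mem_image_of_mem _ u.2⟩ :=
    measurable_pi_lambda _ fun u => (measurable_pi_apply _).comp hφ
  have hm' : Measurable fun (x : Fin m → B) (u : J) =>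
      ψ x ⟨u, Finset.mem_image_of_mem _ u.2⟩ :=
    measurable_pi_lambda _ fun u => (measurable_pi_apply _).comp hψ
  convert hind.comp hm hm' using 1
  · funext ω u
    simp only [Function.comp_apply, ← h]
    rfl
  · funext ω u
    simp only [Function.comp_apply, ← h']
    rfl

/-! ### The σ-algebras of a Lévy process -/

theorem sigmaIncr_le (hL : IsLevyProcess L P) (s t : ℝ≥0) : sigmaIncr L P s t ≤ mΩ :=
  sup_le (iSup_le fun _ => ((hL.measurable _).sub (hL.measurable _)).comap_le) nullSigma_le

theorem sigmaPast_le (hL : IsLevyProcess L P) (t : ℝ≥0) : sigmaPast L P t ≤ mΩ :=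
  sup_le (iSup_le fun _ => (hL.measurable _).comap_le) nullSigma_le

theorem sigmaPast_mono (L : ℝ≥0 → Ω → B) (P : Measure Ω) {s t : ℝ≥0} (h : s ≤ t) :
    sigmaPast L P s ≤ sigmaPast L P t := by
  refine sup_le (iSup_le fun u => le_sup_of_le_left ?_) le_sup_right
  exact le_iSup (fun v : Set.Iic t => MeasurableSpace.comap (L v) inferInstance)
    ⟨u, u.2.trans h⟩

theorem sigmaIncr_le_eventuallyMeasurableSpace (L : ℝ≥0 → Ω → B) (P : Measure Ω) (s t : ℝ≥0) :
    sigmaIncr L P s (s + t) ≤ eventuallyMeasurableSpace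
      (pathSigma L s (Set.Iic t)) (ae P) := by
  refine sup_le (iSup_le fun q => ?_)
    (nullSigma_le_eventuallyMeasurableSpace _)
  obtain ⟨⟨u, v⟩, hu, huv, hv⟩ := q
  refine le_trans (Measurable.comap_le ?_) le_eventuallyMeasurableSpace
  have hu' : u - s ≤ t := tsub_le_iff_left.2 (huv.trans hv)
  have hv' : v - s ≤ t := tsub_le_iff_left.2 hv
  have := (measurable_pathSigma_apply L s (T := Set.Iic t) hv').sub
    (measurable_pathSigma_apply L s (T := Set.Iic t) hu')
  simpa [add_tsub_cancel_of_le hu, add_tsub_cancel_of_le (hu.trans huv), Pi.sub_def] using this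

theorem measurable_sigmaIncr_incrPath (L : ℝ≥0 → Ω → B) (P : Measure Ω) (s t : ℝ≥0) :
    Measurable[sigmaIncr L P s (s + t)] (incrPath L s (Set.Iic t)) := by
  refine @measurable_pi_lambda _ _ _ (sigmaIncr L P s (s + t)) _ _ fun u => ?_
  refine Measurable.mono (comap_measurable fun ω => L (s + u) ω - L s ω) ?_ le_rfl
  refine le_sup_of_le_left ?_
  exact le_iSup_of_le (⟨(s, s + u), le_rfl, le_self_add, add_le_add_right u.2 s⟩ :
    {q : ℝ≥0 × ℝ≥0 // s ≤ q.1 ∧ q.1 ≤ q.2 ∧ q.2 ≤ s + t}) le_rfl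

/-- `L 0` vanishes only almost surely, so `L t` and the path value `L t - L 0` generate the same
sets only up to null sets. -/
theorem comap_le_eventuallyMeasurableSpace_incrPath (hL : IsLevyProcess L P) (T : Set ℝ≥0)
    {t : ℝ≥0} (ht : t ∈ T) :
    MeasurableSpace.comap (L t) inferInstance ≤ eventuallyMeasurableSpace
      (pathSigma L 0 T) (ae P) := by
  refine comap_le_eventuallyMeasurableSpace (g := fun ω => incrPath L 0 T ω ⟨t, ht⟩)
    ((measurable_pi_apply (⟨t, ht⟩ : T)).comp (comap_measurable (incrPath L 0 T))) ?_
  filter_upwards [hL.zero] with ω hω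
  simp [incrPath, hω]

theorem sigmaPast_le_eventuallyMeasurableSpace (hL : IsLevyProcess L P) (t : ℝ≥0) :
    sigmaPast L P t ≤ eventuallyMeasurableSpace
      (pathSigma L 0 (Set.Iic t)) (ae P) :=
  sup_le (iSup_le fun u => hL.comap_le_eventuallyMeasurableSpace_incrPath _ u.2)
    (nullSigma_le_eventuallyMeasurableSpace _)

theorem measurable_sigmaPast_incrPath (L : ℝ≥0 → Ω → B) (P : Measure Ω) (t : ℝ≥0) :
    Measurable[sigmaPast L P t] (incrPath L 0 (Set.Iic t)) := by
  have h : ∀ u ≤ t, Measurable[sigmaPast L P t] (L u) := fun u hu =>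
    Measurable.mono (comap_measurable _)
      (le_sup_of_le_left (le_iSup_of_le (⟨u, hu⟩ : Set.Iic t) le_rfl)) le_rfl
  refine @measurable_pi_lambda _ _ _ (sigmaPast L P t) _ _ fun u => ?_
  exact (h _ ((zero_add _).trans_le u.2)).sub (h _ zero_le)

theorem le_eventuallyMeasurableSpace_incrPath (hL : IsLevyProcess L P) (hgen : mΩ = sigmaAll L) :
    mΩ ≤ eventuallyMeasurableSpace
      (pathSigma L 0 Set.univ) (ae P) := by
  conv_lhs => rw [hgen]
  exact iSup_le fun t => hL.comap_le_eventuallyMeasurableSpace_incrPath _ (Set.mem_univ t)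

/-- Right-continuity recovers every `L t` from times in a countable dense set. This is what makes
`L²` separable. -/
theorem exists_countable_le_eventuallyMeasurableSpace (hL : IsLevyProcess L P)
    (hgen : mΩ = sigmaAll L) : ∃ T : Set ℝ≥0, T.Countable ∧
      mΩ ≤ eventuallyMeasurableSpace
        (pathSigma L 0 T) (ae P) := by
  obtain ⟨D, hDc, hD⟩ := TopologicalSpace.exists_countable_dense ℝ≥0
  refine ⟨D, hDc, ?_⟩
  conv_lhs => rw [hgen]
  refine iSup_le fun t => ?_
  obtain ⟨v, -, hv, hvt⟩ := exists_seq_strictAnti_tendsto t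
  choose q hq htq hqv using fun n => hD.exists_between (hv n)
  have hqt : Tendsto q atTop (𝓝[≥] t) := tendsto_nhdsWithin_iff.2
    ⟨tendsto_of_tendsto_of_tendsto_of_le_of_le tendsto_const_nhds hvt (fun n => (htq n).le)
      fun n => (hqv n).le, Eventually.of_forall fun n => (htq n).le⟩
  -- `limUnder` is measurable whether or not the limit exists; it equals `L t` on the almost sure
  -- event where the path is right-continuous and starts at `0`.
  have hmeas : StronglyMeasurable[pathSigma L 0 D]
      fun ω => limUnder atTop fun n => L (0 + q n) ω - L 0 ω := 
    @StronglyMeasurable.limUnder _ _ _ (pathSigma L 0 D) _ _ _ _ _ _ _ fun n =>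
      (measurable_pathSigma_apply L 0 (hq n)).stronglyMeasurable
  refine comap_le_eventuallyMeasurableSpace hmeas.measurable ?_
  filter_upwards [hL.zero, hL.cadlag] with ω hω hc
  have := (hc t).1.tendsto.comp hqt
  refine (Tendsto.limUnder_eq ?_).symm
  simpa [hω] using! this

end IsLevyProcess

end Paths

/-! ### The semigroup of shifts -/

namespace IsLevyProcess

variable {Ω B : Type*} [NormedAddCommGroup B] [CompleteSpace B] [SecondCountableTopology B]
  [MeasurableSpace B] [BorelSpace B]
  [mΩ : MeasurableSpace Ω] {P : Measure Ω} [IsProbabilityMeasure P] {L : ℝ≥0 → Ω → B}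

set_option linter.unusedSectionVars false

theorem isProbabilityMeasure_map_incrPath (hL : IsLevyProcess L P) (s : ℝ≥0) (T : Set ℝ≥0) :
    IsProbabilityMeasure (P.map (incrPath L s T)) :=
  Measure.isProbabilityMeasure_map (hL.measurable_incrPath s T).aemeasurable

theorem surjective_pullL2_incrPath (hL : IsLevyProcess L P) (hgen : mΩ = sigmaAll L) :
    Function.Surjective (pullL2 P (hL.measurePreserving_incrPath 0 Set.univ)) := fun f => by
  have := hL.isProbabilityMeasure_map_incrPath 0 Set.univ
  exact L2Sub_le_range_pullL2 (hL.measurePreserving_incrPath 0 Set.univ) le_rfl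
    (hL.le_eventuallyMeasurableSpace_incrPath hgen) (mem_lpMeas_self P f)

/-- The isometry of `L²` induced by the shift `L_u - L_0 ↦ L_{s + u} - L_s`. -/
noncomputable def shift (hL : IsLevyProcess L P) (hgen : mΩ = sigmaAll L) (s : ℝ≥0) :
    Lp ℂ 2 P →ₗᵢ[ℂ] Lp ℂ 2 P :=
  (pullL2 P (hL.measurePreserving_incrPath s Set.univ)).comp
    (LinearIsometryEquiv.ofSurjective (pullL2 P (hL.measurePreserving_incrPath 0 Set.univ))
      (hL.surjective_pullL2_incrPath hgen)).symm.toLinearIsometry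

variable (hL : IsLevyProcess L P) (hgen : mΩ = sigmaAll L)

theorem shift_pullL2 (s : ℝ≥0) (g : Lp ℂ 2 (P.map (incrPath L 0 Set.univ))) :
    hL.shift hgen s (pullL2 P (hL.measurePreserving_incrPath 0 Set.univ) g) =
      pullL2 P (hL.measurePreserving_incrPath s Set.univ) g := by
  change pullL2 P _ ((LinearIsometryEquiv.ofSurjective _ _).symm
    (LinearIsometryEquiv.ofSurjective (pullL2 P (hL.measurePreserving_incrPath 0 Set.univ))
      (hL.surjective_pullL2_incrPath hgen) g)) = _
  rw [LinearIsometryEquiv.symm_apply_apply]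

include hL in
-- An a.e. identity between two functions of the path is a statement about its law, and that law is
-- the same for every starting time.
theorem ae_eq_comp_incrPath {s : ℝ≥0} {T : Set ℝ≥0} {β : Type*} {g h : (T → B) → β}
    (hgh : g ∘ incrPath L 0 T =ᵐ[P] h ∘ incrPath L 0 T) (hmeas : MeasurableSet {x | g x = h x}) :
    g ∘ incrPath L s T =ᵐ[P] h ∘ incrPath L s T := by
  have : ∀ᵐ x ∂P.map (incrPath L 0 T), g x = h x :=
    (ae_map_iff (hL.measurable_incrPath 0 T).aemeasurable hmeas).2 hgh
  exact (hL.measurePreserving_incrPath s T).quasiMeasurePreserving.ae this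

/-- The shift acts on functions of the path. -/
theorem shift_ae_eq (s : ℝ≥0) {T : Set ℝ≥0} {h : (T → B) → ℂ} (hh : Measurable h)
    {f : Lp ℂ 2 P} (hf : f =ᵐ[P] h ∘ incrPath L 0 T) :
    hL.shift hgen s f =ᵐ[P] h ∘ incrPath L s T := by
  obtain ⟨g, rfl⟩ := hL.surjective_pullL2_incrPath hgen f
  rw [shift_pullL2]
  refine (pullL2_coeFn _ g).trans ?_
  have hr : Measurable fun (x : ↥(Set.univ : Set ℝ≥0) → B) (u : T) => x ⟨u, Set.mem_univ _⟩ :=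
    measurable_pi_lambda _ fun u => measurable_pi_apply _
  exact hL.ae_eq_comp_incrPath (T := Set.univ) (g := g)
    (h := fun x => h fun u => x ⟨u, Set.mem_univ _⟩)
    ((pullL2_coeFn _ g).symm.trans hf)
    (measurableSet_eq_fun (Lp.stronglyMeasurable g).measurable (hh.comp hr))

theorem shift_indL2 (s : ℝ≥0) {T : Set ℝ≥0} {C : Set (T → B)} (hC : MeasurableSet C) :
    hL.shift hgen s (indL2 P (hL.measurable_incrPath 0 T hC)) =
      indL2 P (hL.measurable_incrPath s T hC) := by
  refine Lp.ext ((hL.shift_ae_eq hgen s (h := C.indicator fun _ => 1)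
    (measurable_const.indicator hC) ?_).trans ?_)
  · exact indL2_coeFn _
  · exact (indL2_coeFn _).symm

include hL hgen in
theorem exists_measurable_comp (f : Lp ℂ 2 P) :
    ∃ h : (↥(Set.univ : Set ℝ≥0) → B) → ℂ, Measurable h ∧ f =ᵐ[P] h ∘ incrPath L 0 Set.univ :=
  exists_measurable_comp_of_mem_L2Sub (hL.measurable_incrPath 0 Set.univ) le_rfl
    (hL.le_eventuallyMeasurableSpace_incrPath hgen) (mem_lpMeas_self P f)

/-- Restarting the path at time `b`. -/
def restart (b : ℝ≥0) (x : ↥(Set.univ : Set ℝ≥0) → B) : ↥(Set.univ : Set ℝ≥0) → B :=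
  fun u => x ⟨b + u, Set.mem_univ _⟩ - x ⟨b, Set.mem_univ _⟩

theorem measurable_restart (b : ℝ≥0) : Measurable (restart (B := B) b) :=
  measurable_pi_lambda _ fun _ => (measurable_pi_apply _).sub (measurable_pi_apply _)

theorem restart_incrPath (a b : ℝ≥0) (ω : Ω) :
    restart b (incrPath L a Set.univ ω) = incrPath L (a + b) Set.univ ω := by
  funext u
  simp [restart, incrPath, add_assoc]

theorem shift_zero : hL.shift hgen 0 = LinearIsometry.id := by
  ext1 f
  obtain ⟨h, hh, hf⟩ := hL.exists_measurable_comp hgen f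
  exact Lp.ext ((hL.shift_ae_eq hgen 0 hh hf).trans hf.symm)

/-- Restarting at `b` the path that was restarted at `a` gives the path restarted at `a + b`. -/
theorem shift_shift (a b : ℝ≥0) (f : Lp ℂ 2 P) :
    hL.shift hgen a (hL.shift hgen b f) = hL.shift hgen (a + b) f := by
  obtain ⟨h, hh, hf⟩ := hL.exists_measurable_comp hgen f
  have hb := hL.shift_ae_eq hgen b hh hf
  refine Lp.ext ((hL.shift_ae_eq hgen a (T := Set.univ) (hh.comp (measurable_restart b)) ?_).trans
    (EventuallyEq.trans ?_ (hL.shift_ae_eq hgen (a + b) hh hf).symm))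
  · refine hb.trans (Eventually.of_forall fun ω => ?_)
    simp only [Function.comp_apply, restart_incrPath, zero_add]
  · exact Eventually.of_forall fun ω => by simp only [Function.comp_apply, restart_incrPath]

theorem shift_mul (a : ℝ≥0) {f g k : Lp ℂ 2 P} (hk : k =ᵐ[P] fun ω => f ω * g ω) :
    hL.shift hgen a k =ᵐ[P] fun ω => hL.shift hgen a f ω * hL.shift hgen a g ω := by
  obtain ⟨φ, hφ, hf⟩ := hL.exists_measurable_comp hgen f
  obtain ⟨ψ, hψ, hg⟩ := hL.exists_measurable_comp hgen g
  refine (hL.shift_ae_eq hgen a (hφ.mul hψ) ?_).trans ?_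
  · refine hk.trans ?_
    filter_upwards [hf, hg] with ω h1 h2
    rw [h1, h2]
    rfl
  · filter_upwards [hL.shift_ae_eq hgen a hφ hf, hL.shift_ae_eq hgen a hψ hg] with ω h1 h2
    rw [h1, h2]
    rfl

/-! ### The shift maps `L²(F_t)` onto `L²(F_{s,s+t})` -/

theorem shift_mem (s t : ℝ≥0) {f : Lp ℂ 2 P} (hf : f ∈ L2Sub P (sigmaPast L P t)) :
    hL.shift hgen s f ∈ L2Sub P (sigmaIncr L P s (s + t)) := by
  obtain ⟨h, hh, hfh⟩ := exists_measurable_comp_of_mem_L2Sub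
    (hL.measurable_incrPath 0 (Set.Iic t)) (hL.sigmaPast_le t)
    (hL.sigmaPast_le_eventuallyMeasurableSpace t) hf
  exact mem_L2Sub_of_ae_eq (hh.comp (measurable_sigmaIncr_incrPath L P s t))
    (hL.shift_ae_eq hgen s hh hfh)

/-- The isometric image of the closed space `L²(F_t)` is closed, and it contains the indicators of
the events of the path restarted at `s`, which generate `F_{s,s+t}` up to null sets. -/
theorem exists_shift_eq (s t : ℝ≥0) {f : Lp ℂ 2 P} (hf : f ∈ L2Sub P (sigmaIncr L P s (s + t))) :
    ∃ g ∈ L2Sub P (sigmaPast L P t), hL.shift hgen s g = f := by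
  have hcl := (hL.shift hgen s).isometry.isClosedEmbedding.isClosedMap _
    (isClosed_L2Sub (P := P) (hL.sigmaPast_le t))
  have hle : L2Sub P (sigmaIncr L P s (s + t)) ≤
      (L2Sub P (sigmaPast L P t)).map (hL.shift hgen s).toLinearMap := by
    refine L2Sub_le (hL.measurable_incrPath s (Set.Iic t)) (hL.sigmaIncr_le _ _)
      (sigmaIncr_le_eventuallyMeasurableSpace L P s t) hcl fun C hC => ?_
    exact ⟨_, indL2_mem_L2Sub (hL.measurable_incrPath 0 (Set.Iic t) hC)
      (measurable_sigmaPast_incrPath L P t hC), hL.shift_indL2 hgen s hC⟩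
  exact hle hf

/-- The unitaries `L²(F_t) → L²(F_{s,s+t})` that extend the shift. -/
noncomputable def shiftFamily : ShiftFamily L P := fun s t =>
  LinearIsometryEquiv.ofSurjective
    (⟨(hL.shift hgen s).toLinearMap.restrict fun _ hf => hL.shift_mem hgen s t hf,
      fun f => (hL.shift hgen s).norm_map f⟩ :
      L2Sub P (sigmaPast L P t) →ₗᵢ[ℂ] L2Sub P (sigmaIncr L P s (s + t)))
    fun f => by
      obtain ⟨g, hg, h⟩ := hL.exists_shift_eq hgen s t f.2
      exact ⟨⟨g, hg⟩, Subtype.ext h⟩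

@[simp]
theorem shiftFamily_coe (s t : ℝ≥0) (f : L2Sub P (sigmaPast L P t)) :
    (hL.shiftFamily hgen s t f : Lp ℂ 2 P) = hL.shift hgen s f := rfl

theorem isShiftFamily_shiftFamily : IsShiftFamily L P (hL.shiftFamily hgen) := by
  intro s t n p hp hp0 hpt τ hτ _ f hf
  rw [shiftFamily_coe]
  have hm : Measurable fun (x : Set.Iic t → B) (i : Fin n) =>
      x ⟨p i.succ, (hp (Fin.le_last _)).trans_eq hpt⟩ -
        x ⟨p i.castSucc, (hp (Fin.le_last _)).trans_eq hpt⟩ :=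
    measurable_pi_lambda _ fun i => (measurable_pi_apply _).sub (measurable_pi_apply _)
  have hi : ∀ r ω, increments L r p ω = fun i => incrPath L r (Set.Iic t) ω
      ⟨p i.succ, (hp (Fin.le_last _)).trans_eq hpt⟩ - incrPath L r (Set.Iic t) ω
        ⟨p i.castSucc, (hp (Fin.le_last _)).trans_eq hpt⟩ := by
    intro r ω
    funext i
    simp [increments, incrPath]
  have := hL.shift_ae_eq hgen s (hτ.comp hm) (f := f) (hf.trans (Eventually.of_forall fun ω => by
    simp only [hi]; rfl))
  exact this.trans (Eventually.of_forall fun ω => by simp only [hi]; rfl)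

include hL in
theorem eq_of_isShiftFamily {S S' : ShiftFamily L P} (hS : IsShiftFamily L P S)
    (hS' : IsShiftFamily L P S') : S' = S := by
  classical
  funext s t
  -- The set where the two families agree is a closed subspace containing the indicators of
  -- cylinders. These form a generating π-system and are functions of finitely many increments.
  set K := LinearMap.eqLocus (S' s t).toLinearMap (S s t).toLinearMap with hK
  have hKc : IsClosed (K : Set (L2Sub P (sigmaPast L P t))) :=
    isClosed_eq (S' s t).continuous (S s t).continuous
  have hV := (isClosed_L2Sub (P := P) (hL.sigmaPast_le t)).isClosedEmbedding_subtypeVal.isClosedMap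
    _ hKc
  have hle : L2Sub P (sigmaPast L P t) ≤ K.map (L2Sub P (sigmaPast L P t)).subtype := by
    refine L2Sub_le_of_generateFrom (hL.measurable_incrPath 0 (Set.Iic t)) (hL.sigmaPast_le t)
      (hL.sigmaPast_le_eventuallyMeasurableSpace t) isPiSystem_measurableCylinders
      generateFrom_measurableCylinders.symm (univ_mem_measurableCylinders _) hV fun C hC hCm => ?_
    obtain ⟨I, A, hA, rfl⟩ := (mem_measurableCylinders _).1 hC
    refine ⟨⟨_, indL2_mem_L2Sub (hL.measurable_incrPath 0 (Set.Iic t) hCm)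
      (measurable_sigmaPast_incrPath L P t hCm)⟩, ?_, rfl⟩
    set I' : Finset ℝ≥0 := I.image (↑) with hI'
    obtain ⟨n, p, hp, hp0, hpt, φ, hφ, h⟩ := exists_incrPath_eq_increments (Ω := Ω) (B := B)
      t I' fun u hu => by
        obtain ⟨v, -, rfl⟩ := Finset.mem_image.1 hu
        exact v.2
    have hm : Measurable fun (x : Fin n → B) (u : I) =>
        φ x ⟨u, Finset.mem_image_of_mem _ u.2⟩ :=
      measurable_pi_lambda _ fun u => (measurable_pi_apply _).comp hφ
    set τ : (Fin n → B) → ℂ := (Set.indicator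
      ((fun (x : Fin n → B) (u : I) => φ x ⟨u, Finset.mem_image_of_mem _ u.2⟩) ⁻¹' A)
        fun _ => 1) with hτ
    have hτm : Measurable τ := measurable_const.indicator (hm hA)
    have hτb : ∃ C : ℝ, ∀ x, ‖τ x‖ ≤ C := ⟨1, fun x => by
      simp only [hτ, Set.indicator_apply]; split_ifs <;> simp⟩
    have hf : (indL2 P (hL.measurable_incrPath 0 (Set.Iic t) hCm) : Ω → ℂ) =ᵐ[P]
        fun ω => τ (increments L 0 p ω) := by
      refine (indL2_coeFn _).trans (Eventually.of_forall fun ω => ?_)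
      simp only [hτ, Set.indicator_apply, Set.mem_preimage, mem_cylinder, ← h]
      rfl
    exact Subtype.ext (Lp.ext ((hS' s t n p hp hp0 hpt τ hτm hτb
      ⟨_, indL2_mem_L2Sub (hL.measurable_incrPath 0 (Set.Iic t) hCm)
        (measurable_sigmaPast_incrPath L P t hCm)⟩ hf).trans
      (hS s t n p hp hp0 hpt τ hτm hτb _ hf).symm))
  refine LinearIsometryEquiv.ext fun f => ?_
  obtain ⟨g, hg, hgf⟩ := hle f.2
  obtain rfl : g = f := Subtype.ext hgf
  exact hg

/-- Where the sample space has a shift, the unitaries are composition with it. -/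
theorem shift_ae_eq_comp (s : ℝ≥0) {σ : Ω → Ω} (hσ : MeasurePreserving σ P P)
    (hLσ : ∀ t, ∀ᵐ ω ∂P, L t (σ ω) = L (s + t) ω - L s ω) (g : Lp ℂ 2 P) :
    hL.shift hgen s g =ᵐ[P] fun ω => g (σ ω) := by
  set V := LinearMap.eqLocus (hL.shift hgen s).toLinearMap (pullL2 P hσ).toLinearMap with hV
  have hVc : IsClosed (V : Set (Lp ℂ 2 P)) :=
    isClosed_eq (hL.shift hgen s).continuous (pullL2 P hσ).continuous
  have hle : L2Sub P mΩ ≤ V := by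
    refine L2Sub_le_of_generateFrom (hL.measurable_incrPath 0 Set.univ) le_rfl
      (hL.le_eventuallyMeasurableSpace_incrPath hgen) isPiSystem_measurableCylinders
      generateFrom_measurableCylinders.symm (univ_mem_measurableCylinders _) hVc fun C hC hCm => ?_
    obtain ⟨I, A, hA, rfl⟩ := (mem_measurableCylinders _).1 hC
    change hL.shift hgen s _ = pullL2 P hσ _
    rw [shift_indL2 hL hgen s hCm, pullL2_indL2]
    refine indL2_congr _ _ ?_
    have hI : ∀ᵐ ω ∂P, ∀ u : I, L (0 + u) (σ ω) = L (s + (0 + u)) ω - L s ω :=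
      ae_all_iff.2 fun u => hLσ _
    -- The hypothesis at time `0` gives `L 0 (σ ω) = 0`, so increments from `0` along `σ ω` are
    -- values of `L`.
    filter_upwards [hI, hLσ 0] with ω h1 h2
    have : I.restrict (incrPath L s Set.univ ω) = I.restrict (incrPath L 0 Set.univ (σ ω)) := by
      funext u
      have := h1 u
      simp only [Finset.restrict, incrPath]
      rw [this, h2, add_zero, sub_self, sub_zero, zero_add]
    exact congrArg A (by exact this)
  have hg : hL.shift hgen s g = pullL2 P hσ g := hle (mem_lpMeas_self P g)
  rw [hg]
  exact pullL2_coeFn hσ g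

end IsLevyProcess

/-! ### Separability of `L²` and strong continuity of the shift -/

namespace IsLevyProcess

variable {Ω B : Type*} [NormedAddCommGroup B] [CompleteSpace B] [SecondCountableTopology B]
  [MeasurableSpace B] [BorelSpace B]
  [mΩ : MeasurableSpace Ω] {P : Measure Ω} [IsProbabilityMeasure P] {L : ℝ≥0 → Ω → B}

theorem separableSpace_L2 (hL : IsLevyProcess L P) (hgen : mΩ = sigmaAll L) :
    TopologicalSpace.SeparableSpace (Lp ℂ 2 P) := by
  obtain ⟨T, hT, hle⟩ := hL.exists_countable_le_eventuallyMeasurableSpace hgen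
  have := hT.to_subtype
  have := hL.isProbabilityMeasure_map_incrPath 0 T
  have : Fact ((2 : ℝ≥0∞) ≠ ∞) := ⟨by norm_num⟩
  have hsurj : Function.Surjective (pullL2 P (hL.measurePreserving_incrPath 0 T)) := fun f =>
    L2Sub_le_range_pullL2 (hL.measurePreserving_incrPath 0 T) le_rfl hle (mem_lpMeas_self P f)
  exact hsurj.denseRange.separableSpace (pullL2 P _).continuous

variable (hL : IsLevyProcess L P) (hgen : mΩ = sigmaAll L)

/-- Right-continuity and dominated convergence give `⟨g, S_r g⟩ → ⟨g, g⟩`. As `S_r` is isometric,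
`‖S_r g - g‖² = 2‖g‖² - 2 Re ⟨g, S_r g⟩`, so the convergence is in norm. -/
theorem tendsto_shift_pullL2_toLp {T : Set ℝ≥0} [Fintype T]
    [IsFiniteMeasure (P.map (incrPath L 0 T))]
    (φ : BoundedContinuousFunction (T → B) ℂ) :
    Tendsto (fun r => hL.shift hgen r (pullL2 P (hL.measurePreserving_incrPath 0 T)
        (φ.toLp 2 (P.map (incrPath L 0 T)) ℂ))) (𝓝[>] 0)
      (𝓝 (pullL2 P (hL.measurePreserving_incrPath 0 T)
        (φ.toLp 2 (P.map (incrPath L 0 T)) ℂ))) := by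
  set g := pullL2 P (hL.measurePreserving_incrPath 0 T) (φ.toLp 2 (P.map (incrPath L 0 T)) ℂ)
    with hg
  have hg0 : g =ᵐ[P] φ ∘ incrPath L 0 T := (pullL2_coeFn _ _).trans
    ((hL.measurePreserving_incrPath 0 T).quasiMeasurePreserving.ae_eq_comp
      (φ.coeFn_toLp 2 (P.map (incrPath L 0 T)) ℂ))
  have hgr : ∀ r, hL.shift hgen r g =ᵐ[P] φ ∘ incrPath L r T := fun r =>
    hL.shift_ae_eq hgen r φ.continuous.measurable hg0
  have hinner : Tendsto (fun r => inner ℂ g (hL.shift hgen r g)) (𝓝[>] 0) (𝓝 (inner ℂ g g)) := by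
    have h1 : ∀ r, inner ℂ g (hL.shift hgen r g) =
        ∫ ω, φ (incrPath L r T ω) * starRingEnd ℂ (φ (incrPath L 0 T ω)) ∂P := by
      intro r
      rw [L2.inner_def]
      refine integral_congr_ae ?_
      filter_upwards [hg0, hgr r] with ω h1 h2
      rw [h1, h2]
      rfl
    have h2 : inner ℂ g g =
        ∫ ω, φ (incrPath L 0 T ω) * starRingEnd ℂ (φ (incrPath L 0 T ω)) ∂P := by
      rw [L2.inner_def]
      refine integral_congr_ae ?_
      filter_upwards [hg0] with ω h1
      rw [h1]
      rfl
    simp_rw [h1, h2]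
    refine tendsto_integral_filter_of_dominated_convergence (fun _ => ‖φ‖ * ‖φ‖)
      (Eventually.of_forall fun r => ?_) (Eventually.of_forall fun r =>
        Eventually.of_forall fun ω => ?_) (integrable_const _) ?_
    · exact ((φ.continuous.measurable.comp (hL.measurable_incrPath r T)).mul
        (continuous_star.measurable.comp
          (φ.continuous.measurable.comp (hL.measurable_incrPath 0 T)))).aestronglyMeasurable
    · rw [norm_mul, RCLike.norm_conj]
      gcongr <;> exact φ.norm_coe_le_norm _
    · filter_upwards [hL.cadlag] with ω hω
      refine Tendsto.mul_const _ ((φ.continuous.tendsto _).comp (tendsto_pi_nhds.2 fun u => ?_))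
      have key : ∀ v : ℝ≥0, Tendsto (fun r => L (r + v) ω) (𝓝[>] 0) (𝓝 (L v ω)) := by
        intro v
        refine (hω v).1.tendsto.comp (tendsto_nhdsWithin_iff.2 ⟨?_, ?_⟩)
        · have : Tendsto (fun r : ℝ≥0 => r + v) (𝓝 0) (𝓝 (0 + v)) :=
            (continuous_add_const v).tendsto 0
          rw [zero_add] at this
          exact this.mono_left nhdsWithin_le_nhds
        · exact Eventually.of_forall fun r => Set.mem_Ici.2 le_add_self
      have h0 := key 0
      simp only [add_zero] at h0
      simpa [incrPath] using (key u).sub h0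
  rw [tendsto_iff_norm_sub_tendsto_zero]
  have hsq : ∀ r, ‖hL.shift hgen r g - g‖ ^ 2 =
      2 * ‖g‖ ^ 2 - 2 * (inner ℂ g (hL.shift hgen r g)).re := by
    intro r
    rw [@norm_sub_sq ℂ, (hL.shift hgen r).norm_map, ← inner_conj_symm]
    simp only [RCLike.conj_re, RCLike.re_to_complex]
    ring
  have hre := (Complex.continuous_re.tendsto _).comp hinner
  have hself : (inner ℂ g g : ℂ).re = ‖g‖ ^ 2 := by
    rw [← inner_self_eq_norm_sq (𝕜 := ℂ)]
    rfl
  rw [hself] at hre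
  have hlim : Tendsto (fun r => ‖hL.shift hgen r g - g‖ ^ 2) (𝓝[>] 0) (𝓝 0) := by
    simp_rw [hsq]
    have := (tendsto_const_nhds (x := 2 * ‖g‖ ^ 2)).sub (hre.const_mul 2)
    simpa using! this
  have := (Real.continuous_sqrt.tendsto _).comp hlim
  simpa [Function.comp_def, Real.sqrt_sq] using this

theorem norm_shift_sub_self_le (r : ℝ≥0) (f g : Lp ℂ 2 P) :
    ‖hL.shift hgen r f - f‖ ≤ 2 * ‖f - g‖ + ‖hL.shift hgen r g - g‖ := by
  have h1 : hL.shift hgen r f - f =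
      hL.shift hgen r (f - g) + (hL.shift hgen r g - g) + (g - f) := by
    rw [map_sub]; abel
  rw [h1]
  refine (norm_add₃_le ..).trans ?_
  rw [(hL.shift hgen r).norm_map, norm_sub_rev g f]
  linarith

/-- The vectors at which the shift is strongly continuous. -/
def continuousShift : Submodule ℂ (Lp ℂ 2 P) where
  carrier := {f | Tendsto (fun r => hL.shift hgen r f) (𝓝[>] 0) (𝓝 f)}
  zero_mem' := by simp
  add_mem' hf hg := by simpa using Tendsto.add hf hg
  smul_mem' c f hf := by simpa using Tendsto.const_smul hf c

theorem isClosed_continuousShift :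
    IsClosed (hL.continuousShift hgen : Set (Lp ℂ 2 P)) := by
  refine isClosed_of_closure_subset fun f hf => ?_
  change Tendsto _ _ _
  rw [Metric.tendsto_nhds]
  intro ε hε
  obtain ⟨g, hg, hfg⟩ := Metric.mem_closure_iff.1 hf (ε / 4) (by positivity)
  filter_upwards [Metric.tendsto_nhds.1 hg (ε / 2) (by positivity)] with r hr
  rw [dist_eq_norm] at hfg hr ⊢
  have := hL.norm_shift_sub_self_le hgen r f g
  linarith

theorem tendsto_shift (f : Lp ℂ 2 P) :
    Tendsto (fun r => hL.shift hgen r f) (𝓝[>] 0) (𝓝 f) := by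
  classical
  have hcl := hL.isClosed_continuousShift hgen
  have hle : L2Sub P mΩ ≤ hL.continuousShift hgen := by
    refine L2Sub_le_of_generateFrom (hL.measurable_incrPath 0 Set.univ) le_rfl
      (hL.le_eventuallyMeasurableSpace_incrPath hgen) isPiSystem_measurableCylinders
      generateFrom_measurableCylinders.symm (univ_mem_measurableCylinders _) hcl fun C hC hCm => ?_
    obtain ⟨I, A, hA, rfl⟩ := (mem_measurableCylinders _).1 hC
    set T : Set ℝ≥0 := (↑) '' (I : Set (Set.univ : Set ℝ≥0)) with hT
    have hfin : T.Finite := I.finite_toSet.image _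
    have := hfin.fintype
    have := hL.isProbabilityMeasure_map_incrPath 0 T
    -- An indicator is not a continuous function of the path, but bounded continuous functions are
    -- dense in `L²` of the finite-dimensional law, and the continuity vectors form a closed
    -- subspace.
    have hrange : ∀ g, pullL2 P (hL.measurePreserving_incrPath 0 T) g ∈
        hL.continuousShift hgen := by
      intro g
      refine (BoundedContinuousFunction.toLp_denseRange (p := 2) (E := ℂ)
        (μ := P.map (incrPath L 0 T)) ℂ (by norm_num)).induction_on
        (p := fun g => pullL2 P (hL.measurePreserving_incrPath 0 T) g ∈
          hL.continuousShift hgen) g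
        (hcl.preimage (pullL2 P _).continuous) fun φ => ?_
      exact hL.tendsto_shift_pullL2_toLp hgen φ
    have hr : Measurable fun (x : T → B) (u : I) => x ⟨u, Set.mem_image_of_mem _ u.2⟩ :=
      measurable_pi_lambda _ fun u => measurable_pi_apply _
    have := hrange (indL2 _ (hr hA))
    rw [pullL2_indL2] at this
    exact this
  exact hle (mem_lpMeas_self P f)

/-- With `a = b + h` this is `S_a = S_b S_h` and the isometry of `S_b`. Continuity at `0` thereby
becomes continuity everywhere. -/
theorem norm_shift_sub_shift (a b : ℝ≥0) (f : Lp ℂ 2 P) :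
    ‖hL.shift hgen a f - hL.shift hgen b f‖ = ‖hL.shift hgen (nndist a b) f - f‖ := by
  wlog h : b ≤ a generalizing a b
  · rw [norm_sub_rev, this b a (le_of_not_ge h), nndist_comm]
  · have : a = b + nndist a b := by
      rw [NNReal.nndist_eq, tsub_eq_zero_of_le h, max_eq_left zero_le, add_tsub_cancel_of_le h]
    conv_lhs => rw [this]
    rw [← shift_shift, ← map_sub, (hL.shift hgen b).norm_map]

theorem continuous_shift_apply (f : Lp ℂ 2 P) : Continuous fun r => hL.shift hgen r f := by
  have h0 : Tendsto (fun r => ‖hL.shift hgen r f - f‖) (𝓝 0) (𝓝 0) := by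
    have h1 := tendsto_iff_norm_sub_tendsto_zero.1 (hL.tendsto_shift hgen f)
    -- As `0` is the least time, a full neighbourhood of `0` is a right one together with the point
    -- itself.
    have h2 : 𝓝 (0 : ℝ≥0) = 𝓝[>] 0 ⊔ pure 0 := by
      rw [sup_comm, ← nhdsNE_sup_pure, sup_comm]
      congr 2
      ext r
      simp [pos_iff_ne_zero]
    rw [h2]
    refine h1.sup ?_
    rw [tendsto_pure_left]
    intro s hs
    simpa [shift_zero] using mem_of_mem_nhds hs
  refine continuous_iff_continuousAt.2 fun a => tendsto_iff_norm_sub_tendsto_zero.2 ?_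
  simp_rw [norm_shift_sub_shift]
  refine h0.comp ?_
  have : Continuous fun b : ℝ≥0 => nndist b a := by fun_prop
  simpa using this.tendsto a

/-- Continuity in time for each vector, together with a Lipschitz bound in the vector uniform in
time, gives joint continuity. -/
theorem continuous_shift :
    Continuous fun q : ℝ≥0 × Lp ℂ 2 P => hL.shift hgen q.1 q.2 :=
  continuous_prod_of_continuous_lipschitzWith' _ 1
    (fun a => (hL.shift hgen a).lipschitz) (hL.continuous_shift_apply hgen)

end IsLevyProcess

/-! ### Isometries of the Hilbert space tensor product -/

section HilbertTensor

variable {H K M : Type*} [NormedAddCommGroup H] [InnerProductSpace ℂ H]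
  [NormedAddCommGroup K] [InnerProductSpace ℂ K] [NormedAddCommGroup M] [InnerProductSpace ℂ M]

/-- A bilinear map that multiplies inner products and has total range extends to a unitary of the
Hilbert space tensor product. -/
theorem exists_hilbertTensor_equiv [CompleteSpace M] (b : H →ₗ[ℂ] K →ₗ[ℂ] M)
    (hb : ∀ x x' y y', inner ℂ (b x y) (b x' y') = inner ℂ x x' * inner ℂ y y')
    (hd : ∀ V : Submodule ℂ M, IsClosed (V : Set M) → (∀ x y, b x y ∈ V) → V = ⊤) :
    ∃ U : HilbertTensor H K ≃ₗᵢ[ℂ] M, ∀ x y, U (pureTensor x y) = b x y := by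
  set l : H ⊗[ℂ] K →ₗ[ℂ] M := TensorProduct.lift b with hl
  have hinner : ∀ z w, inner ℂ (l z) (l w) = inner ℂ z w := by
    intro z w
    induction z using TensorProduct.induction_on with
    | zero => simp
    | add z z' hz hz' => rw [map_add, inner_add_left, inner_add_left, hz, hz']
    | tmul x y =>
      induction w using TensorProduct.induction_on with
      | zero => simp
      | add w w' hw hw' => rw [map_add, inner_add_right, inner_add_right, hw, hw']
      | tmul x' y' =>
        rw [hl, TensorProduct.lift.tmul, TensorProduct.lift.tmul, hb, TensorProduct.inner_tmul]
  set li : H ⊗[ℂ] K →ₗᵢ[ℂ] M := l.isometryOfInner hinner with hli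
  have hdense : DenseRange (UniformSpace.Completion.toComplL (𝕜 := ℂ) (E := H ⊗[ℂ] K)) :=
    UniformSpace.Completion.denseRange_coe
  have hind : IsUniformInducing (UniformSpace.Completion.toComplL (𝕜 := ℂ) (E := H ⊗[ℂ] K)) :=
    UniformSpace.Completion.isUniformInducing_coe _
  set e : HilbertTensor H K →L[ℂ] M :=
    li.toContinuousLinearMap.extend (UniformSpace.Completion.toComplL (𝕜 := ℂ)) with he
  have hext : ∀ z : H ⊗[ℂ] K, e (z : HilbertTensor H K) = l z := fun z =>
    ContinuousLinearMap.extend_eq _ hdense hind z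
  have hnorm : ∀ z : HilbertTensor H K, ‖e z‖ = ‖z‖ := by
    intro z
    induction z using UniformSpace.Completion.induction_on with
    | hp => exact isClosed_eq e.continuous.norm continuous_norm
    | ih z => rw [hext, UniformSpace.Completion.norm_coe]; exact li.norm_map z
  set ei : HilbertTensor H K →ₗᵢ[ℂ] M := ⟨e.toLinearMap, hnorm⟩ with hei
  have hpure : ∀ x y, ei (pureTensor x y) = b x y := fun x y => (hext _).trans (TensorProduct.lift.tmul _ _)
  -- The range is closed and contains all values of `b`, so totality makes it everything.
  have hsurj : Function.Surjective ei := by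
    refine LinearMap.range_eq_top.1 (hd _ (isClosed_range_linearIsometry ei) fun x y => ?_)
    exact ⟨_, hpure x y⟩
  exact ⟨LinearIsometryEquiv.ofSurjective ei hsurj, hpure⟩

theorem hilbertTensor_equiv_ext {U U' : HilbertTensor H K ≃ₗᵢ[ℂ] M}
    (h : ∀ x y, U (pureTensor x y) = U' (pureTensor x y)) : U = U' := by
  refine LinearIsometryEquiv.ext fun z => ?_
  induction z using UniformSpace.Completion.induction_on with
  | hp => exact isClosed_eq U.continuous U'.continuous
  | ih z =>
    induction z using TensorProduct.induction_on with
    | zero => rw [UniformSpace.Completion.coe_zero, map_zero, map_zero]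
    | add z w hz hw => rw [UniformSpace.Completion.coe_add, map_add, map_add, hz, hw]
    | tmul x y => exact h x y

end HilbertTensor

/-! ### The multiplication -/

namespace IsLevyProcess

set_option linter.unusedSectionVars false

variable {Ω B : Type*} [NormedAddCommGroup B] [CompleteSpace B] [SecondCountableTopology B]
  [MeasurableSpace B] [BorelSpace B]
  [mΩ : MeasurableSpace Ω] {P : Measure Ω} [IsProbabilityMeasure P] {L : ℝ≥0 → Ω → B}

variable (hL : IsLevyProcess L P) (hgen : mΩ = sigmaAll L)

include hL in
theorem exists_measurable_comp_sigmaPast {s : ℝ≥0} {f : Lp ℂ 2 P}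
    (hf : f ∈ L2Sub P (sigmaPast L P s)) :
    ∃ h : (Set.Iic s → B) → ℂ, Measurable h ∧ f =ᵐ[P] h ∘ incrPath L 0 (Set.Iic s) :=
  exists_measurable_comp_of_mem_L2Sub (hL.measurable_incrPath 0 (Set.Iic s)) (hL.sigmaPast_le s)
    (hL.sigmaPast_le_eventuallyMeasurableSpace s) hf

/-- A product of two `L²` functions is in general only in `L¹`. Here `|f|²` and `|S_s g|²` are
independent, so their product is integrable. -/
theorem memLp_mul_shift {s : ℝ≥0} {f : Lp ℂ 2 P} (hf : f ∈ L2Sub P (sigmaPast L P s))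
    (g : Lp ℂ 2 P) : MemLp (fun ω => f ω * hL.shift hgen s g ω) 2 P := by
  obtain ⟨φ, hφ, hfφ⟩ := hL.exists_measurable_comp_sigmaPast hf
  obtain ⟨ψ, hψ, hgψ⟩ := hL.exists_measurable_comp hgen g
  have hgs := hL.shift_ae_eq hgen s hψ hgψ
  have hm : AEStronglyMeasurable (fun ω => f ω * hL.shift hgen s g ω) P :=
    (Lp.aestronglyMeasurable f).mul (Lp.aestronglyMeasurable _)
  rw [memLp_two_iff_integrable_sq_norm hm]
  have h1 : Integrable (fun ω => ‖φ (incrPath L 0 (Set.Iic s) ω)‖ ^ 2) P :=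
    ((memLp_two_iff_integrable_sq_norm (Lp.aestronglyMeasurable f)).1 (Lp.memLp f)).congr
      (hfφ.mono fun ω h => by simp only [h, Function.comp_apply])
  have h2 : Integrable (fun ω => ‖ψ (incrPath L s Set.univ ω)‖ ^ 2) P :=
    ((memLp_two_iff_integrable_sq_norm (Lp.aestronglyMeasurable _)).1
      (Lp.memLp (hL.shift hgen s g))).congr
      (hgs.mono fun ω h => by simp only [h, Function.comp_apply])
  have hind := (hL.indepFun_incrPath s Set.univ).comp (hφ.norm.pow_const 2) (hψ.norm.pow_const 2)
  refine (hind.integrable_mul h1 h2).congr ?_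
  filter_upwards [hfφ, hgs] with ω h3 h4
  simp [h3, h4, mul_pow]

/-- The multiplication `(f, g) ↦ f · S_s g`. -/
noncomputable def mulShift (s : ℝ≥0) :
    L2Sub P (sigmaPast L P s) →ₗ[ℂ] Lp ℂ 2 P →ₗ[ℂ] Lp ℂ 2 P :=
  LinearMap.mk₂ ℂ (fun f g => (hL.memLp_mul_shift hgen f.2 g).toLp _)
    (fun f f' g => by
      refine Lp.ext ?_
      filter_upwards [(hL.memLp_mul_shift hgen f.2 g).coeFn_toLp,
        (hL.memLp_mul_shift hgen f'.2 g).coeFn_toLp,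
        (hL.memLp_mul_shift hgen (f + f').2 g).coeFn_toLp,
        Lp.coeFn_add (f : Lp ℂ 2 P) f', Lp.coeFn_add ((hL.memLp_mul_shift hgen f.2 g).toLp _)
          ((hL.memLp_mul_shift hgen f'.2 g).toLp _)] with ω h1 h2 h3 h4 h5
      rw [h3, h5, Pi.add_apply, h1, h2, Submodule.coe_add, h4, Pi.add_apply, add_mul])
    (fun c f g => by
      refine Lp.ext ?_
      filter_upwards [(hL.memLp_mul_shift hgen f.2 g).coeFn_toLp,
        (hL.memLp_mul_shift hgen (c • f).2 g).coeFn_toLp,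
        Lp.coeFn_smul c (f : Lp ℂ 2 P),
        Lp.coeFn_smul c ((hL.memLp_mul_shift hgen f.2 g).toLp _)] with ω h1 h2 h3 h4
      rw [h2, h4, Pi.smul_apply, h1, Submodule.coe_smul, h3, Pi.smul_apply, smul_mul_assoc])
    (fun f g g' => by
      refine Lp.ext ?_
      filter_upwards [(hL.memLp_mul_shift hgen f.2 g).coeFn_toLp,
        (hL.memLp_mul_shift hgen f.2 g').coeFn_toLp,
        (hL.memLp_mul_shift hgen f.2 (g + g')).coeFn_toLp,
        Lp.coeFn_add (hL.shift hgen s g) (hL.shift hgen s g'),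
        Lp.coeFn_add ((hL.memLp_mul_shift hgen f.2 g).toLp _)
          ((hL.memLp_mul_shift hgen f.2 g').toLp _)] with ω h1 h2 h3 h4 h5
      rw [h3, h5, Pi.add_apply, h1, h2, map_add, h4, Pi.add_apply, mul_add])
    (fun c f g => by
      refine Lp.ext ?_
      filter_upwards [(hL.memLp_mul_shift hgen f.2 g).coeFn_toLp,
        (hL.memLp_mul_shift hgen f.2 (c • g)).coeFn_toLp,
        Lp.coeFn_smul c (hL.shift hgen s g),
        Lp.coeFn_smul c ((hL.memLp_mul_shift hgen f.2 g).toLp _)] with ω h1 h2 h3 h4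
      rw [h2, h4, Pi.smul_apply, h1, map_smul, h3, Pi.smul_apply, mul_smul_comm])

theorem mulShift_ae_eq {s : ℝ≥0} (f : L2Sub P (sigmaPast L P s)) (g : Lp ℂ 2 P) :
    hL.mulShift hgen s f g =ᵐ[P] fun ω => (f : Lp ℂ 2 P) ω * hL.shift hgen s g ω :=
  (hL.memLp_mul_shift hgen f.2 g).coeFn_toLp

/-- The integrand splits into a factor depending on the past and one depending on the restarted
path. Independence factors the expectation, and the shift preserves inner products. -/
theorem inner_mulShift {s : ℝ≥0} (f f' : L2Sub P (sigmaPast L P s)) (g g' : Lp ℂ 2 P) :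
    inner ℂ (hL.mulShift hgen s f g) (hL.mulShift hgen s f' g') = inner ℂ f f' * inner ℂ g g' := by
  obtain ⟨φ, hφ, hf⟩ := hL.exists_measurable_comp_sigmaPast f.2
  obtain ⟨φ', hφ', hf'⟩ := hL.exists_measurable_comp_sigmaPast f'.2
  obtain ⟨ψ, hψ, hg⟩ := hL.exists_measurable_comp hgen g
  obtain ⟨ψ', hψ', hg'⟩ := hL.exists_measurable_comp hgen g'
  rw [← (hL.shift hgen s).inner_map_map g g', Submodule.coe_inner, L2.inner_def, L2.inner_def,
    L2.inner_def]
  have key := (hL.indepFun_incrPath s Set.univ).integral_fun_comp_mul_comp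
    (f := fun x => inner ℂ (φ x) (φ' x)) (g := fun x => inner ℂ (ψ x) (ψ' x))
    (hL.measurable_incrPath 0 _).aemeasurable (hL.measurable_incrPath s _).aemeasurable
    (hφ.inner hφ').aestronglyMeasurable (hψ.inner hψ').aestronglyMeasurable
  have hgs := hL.shift_ae_eq hgen s hψ hg
  have hgs' := hL.shift_ae_eq hgen s hψ' hg'
  convert key using 1
  · refine integral_congr_ae ?_
    filter_upwards [hf, hf', hgs, hgs', hL.mulShift_ae_eq hgen f g,
      hL.mulShift_ae_eq hgen f' g'] with ω h1 h2 h3 h4 h5 h6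
    rw [h5, h6, h1, h2, h3, h4]
    simp only [Function.comp_apply, RCLike.inner_apply, map_mul]
    ring
  · congr 1
    · refine integral_congr_ae ?_
      filter_upwards [hf, hf'] with ω h1 h2
      rw [h1, h2]
      rfl
    · refine integral_congr_ae ?_
      filter_upwards [hgs, hgs'] with ω h1 h2
      rw [h1, h2]
      rfl

theorem norm_mulShift {s : ℝ≥0} (f : L2Sub P (sigmaPast L P s)) (g : Lp ℂ 2 P) :
    ‖hL.mulShift hgen s f g‖ = ‖f‖ * ‖g‖ := by
  have h := hL.inner_mulShift hgen f f g g
  have hf : inner ℂ f f = (‖f‖ : ℂ) ^ 2 := inner_self_eq_norm_sq_to_K f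
  rw [hf, inner_self_eq_norm_sq_to_K, inner_self_eq_norm_sq_to_K, ← mul_pow] at h
  have h' : ‖hL.mulShift hgen s f g‖ ^ 2 = (‖f‖ * ‖g‖) ^ 2 := by
    refine Complex.ofReal_injective ?_
    push_cast
    exact h
  exact (pow_left_inj₀ (norm_nonneg _) (by positivity) two_ne_zero).1 h'

theorem shift_mem_sigmaPast (s t : ℝ≥0) {f : Lp ℂ 2 P} (hf : f ∈ L2Sub P (sigmaPast L P t)) :
    hL.shift hgen s f ∈ L2Sub P (sigmaPast L P (s + t)) := by
  refine mem_lpMeas_iff_aestronglyMeasurable.2 ((mem_lpMeas_iff_aestronglyMeasurable.1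
    (hL.shift_mem hgen s t hf)).mono (sup_le (iSup_le fun q => ?_) le_sup_right))
  have h : ∀ u ≤ s + t, Measurable[sigmaPast L P (s + t)] (L u) := fun u hu =>
    Measurable.mono (comap_measurable _)
      (le_sup_of_le_left (le_iSup_of_le (⟨u, hu⟩ : Set.Iic (s + t)) le_rfl)) le_rfl
  exact ((h _ q.2.2.2).sub (h _ (q.2.2.1.trans q.2.2.2))).comap_le

theorem mulShift_mem {s t : ℝ≥0} (f : L2Sub P (sigmaPast L P s))
    (g : L2Sub P (sigmaPast L P t)) :
    hL.mulShift hgen s f g ∈ L2Sub P (sigmaPast L P (s + t)) := by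
  refine mem_lpMeas_iff_aestronglyMeasurable.2 (AEStronglyMeasurable.congr ?_
    (hL.mulShift_ae_eq hgen f g).symm)
  exact ((mem_lpMeas_iff_aestronglyMeasurable.1 f.2).mono
    (sigmaPast_mono L P le_self_add)).mul
    (mem_lpMeas_iff_aestronglyMeasurable.1 (hL.shift_mem_sigmaPast hgen s t g.2))

/-- The multiplication `L²(F_s) × L²(F_t) → L²(F_{s+t})`. -/
noncomputable def mulFibre (s t : ℝ≥0) : L2Sub P (sigmaPast L P s) →ₗ[ℂ]
    L2Sub P (sigmaPast L P t) →ₗ[ℂ] L2Sub P (sigmaPast L P (s + t)) :=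
  LinearMap.mk₂ ℂ (fun f g => ⟨hL.mulShift hgen s f g, hL.mulShift_mem hgen f g⟩)
    (fun f f' g => Subtype.ext (by simp))
    (fun c f g => Subtype.ext (by simp))
    (fun f g g' => Subtype.ext (by simp))
    (fun c f g => Subtype.ext (by simp))

@[simp]
theorem mulFibre_coe {s t : ℝ≥0} (f : L2Sub P (sigmaPast L P s)) (g : L2Sub P (sigmaPast L P t)) :
    (hL.mulFibre hgen s t f g : Lp ℂ 2 P) = hL.mulShift hgen s f g := rfl

include hL in
-- For `u ≥ s`, almost surely `L u = (L s - L 0) + (L u - L s)`.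
theorem sigmaPast_add_le (s t : ℝ≥0) : sigmaPast L P (s + t) ≤ eventuallyMeasurableSpace
    (MeasurableSpace.comap (fun ω => (incrPath L 0 (Set.Iic s) ω, incrPath L s (Set.Iic t) ω))
      inferInstance) (ae P) := by
  have h0 := hL.zero
  set m : MeasurableSpace Ω := MeasurableSpace.comap
    (fun ω => (incrPath L 0 (Set.Iic s) ω, incrPath L s (Set.Iic t) ω)) inferInstance with hm
  have h1 : Measurable[m] (incrPath L 0 (Set.Iic s)) := measurable_fst.comp (comap_measurable _)
  have h2 : Measurable[m] (incrPath L s (Set.Iic t)) := measurable_snd.comp (comap_measurable _)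
  have h1' : ∀ u, ∀ hu : u ≤ s, Measurable[m] fun ω => incrPath L 0 (Set.Iic s) ω ⟨u, hu⟩ :=
    fun u hu => (measurable_pi_apply (⟨u, hu⟩ : Set.Iic s)).comp h1
  have h2' : ∀ u, ∀ hu : u ≤ t, Measurable[m] fun ω => incrPath L s (Set.Iic t) ω ⟨u, hu⟩ :=
    fun u hu => (measurable_pi_apply (⟨u, hu⟩ : Set.Iic t)).comp h2
  refine sup_le (iSup_le fun ⟨u, hu⟩ => ?_) (nullSigma_le_eventuallyMeasurableSpace _)
  rcases le_total u s with hus | hsu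
  · refine comap_le_eventuallyMeasurableSpace (h1' u hus) ?_
    filter_upwards [h0] with ω hω
    simp [incrPath, hω]
  · refine comap_le_eventuallyMeasurableSpace
      ((h1' s le_rfl).add (h2' (u - s) (tsub_le_iff_left.2 hu))) ?_
    filter_upwards [h0] with ω hω
    simp [incrPath, hω, add_tsub_cancel_of_le hsu]

/-- The indicator of a rectangle `C₁ ×ˢ C₂` in the two path pieces is the product of `1_{C₁}` with
the shift of `1_{C₂}`. Rectangles form a π-system generating the product σ-algebra. -/
theorem eq_top_of_mulFibre_mem {s t : ℝ≥0} (V : Submodule ℂ (L2Sub P (sigmaPast L P (s + t))))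
    (hV : IsClosed (V : Set (L2Sub P (sigmaPast L P (s + t)))))
    (h : ∀ f g, hL.mulFibre hgen s t f g ∈ V) : V = ⊤ := by
  have hVc := (isClosed_L2Sub (P := P) (hL.sigmaPast_le (s + t))).isClosedEmbedding_subtypeVal
    |>.isClosedMap _ hV
  have hm := (hL.measurable_incrPath 0 (Set.Iic s)).prodMk (hL.measurable_incrPath s (Set.Iic t))
  have hle : L2Sub P (sigmaPast L P (s + t)) ≤
      V.map (L2Sub P (sigmaPast L P (s + t))).subtype := by
    refine L2Sub_le_of_generateFrom hm (hL.sigmaPast_le _) (hL.sigmaPast_add_le s t)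
      isPiSystem_prod generateFrom_prod.symm
      ⟨Set.univ, by simp, Set.univ, by simp, Set.univ_prod_univ⟩ hVc
      fun C hC hCm => ?_
    obtain ⟨C₁, hC₁, C₂, hC₂, rfl⟩ := hC
    refine ⟨_, h ⟨_, indL2_mem_L2Sub (hL.measurable_incrPath 0 (Set.Iic s) hC₁)
      (measurable_sigmaPast_incrPath L P s hC₁)⟩
      ⟨_, indL2_mem_L2Sub (hL.measurable_incrPath 0 (Set.Iic t) hC₂)
        (measurable_sigmaPast_incrPath L P t hC₂)⟩, ?_⟩
    change hL.mulShift hgen s _ _ = _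
    refine Lp.ext ((hL.mulShift_ae_eq hgen _ _).trans ?_)
    dsimp only
    rw [hL.shift_indL2 hgen s hC₂]
    filter_upwards [indL2_coeFn (P := P) (hL.measurable_incrPath 0 (Set.Iic s) hC₁),
      indL2_coeFn (P := P) (hL.measurable_incrPath s (Set.Iic t) hC₂),
      indL2_coeFn (P := P) (hm hCm)] with ω h1 h2 h3
    rw [h1, h2, h3]
    by_cases hω₁ : incrPath L 0 (Set.Iic s) ω ∈ C₁ <;>
      by_cases hω₂ : incrPath L s (Set.Iic t) ω ∈ C₂ <;> simp [hω₁, hω₂]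
  refine eq_top_iff.2 fun f _ => ?_
  obtain ⟨g, hg, hgf⟩ := hle f.2
  obtain rfl : g = f := Subtype.ext hgf
  exact hg

theorem exists_levyMultiplication : ∃ U : ∀ s t : PosTime,
    HilbertTensor (levyFibre L P s) (levyFibre L P t) ≃ₗᵢ[ℂ] levyFibre L P (s + t),
    ∀ s t f g, (U s t (pureTensor f g) : Lp ℂ 2 P) = hL.mulShift hgen s f g := by
  have : ∀ s t : PosTime, ∃ U :
      HilbertTensor (levyFibre L P s) (levyFibre L P t) ≃ₗᵢ[ℂ] levyFibre L P (s + t),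
      ∀ f g, U (pureTensor f g) = hL.mulFibre hgen s t f g := by
    intro s t
    have : CompleteSpace (L2Sub P (sigmaPast L P ((s : ℝ≥0) + t))) :=
      (isClosed_L2Sub (P := P) (hL.sigmaPast_le _)).completeSpace_coe
    exact exists_hilbertTensor_equiv (hL.mulFibre hgen s t)
      (fun f f' g g' => hL.inner_mulShift hgen f f' g g')
      fun V hV h => hL.eq_top_of_mulFibre_mem hgen V hV h
  choose U hU using this
  exact ⟨U, fun s t f g => congrArg Subtype.val (hU s t f g)⟩

theorem isLevyMultiplication_iff {U : ∀ s t : PosTime,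
    HilbertTensor (levyFibre L P s) (levyFibre L P t) ≃ₗᵢ[ℂ] levyFibre L P (s + t)} :
    IsLevyMultiplication L P (hL.shiftFamily hgen) U ↔
      ∀ s t f g, (U s t (pureTensor f g) : Lp ℂ 2 P) = hL.mulShift hgen s f g := by
  refine ⟨fun h s t f g => Lp.ext ((h s t f g).trans (hL.mulShift_ae_eq hgen f g).symm),
    fun h s t f g => ?_⟩
  rw [h]
  exact hL.mulShift_ae_eq hgen f g

/-- Both sides equal `f · S_r g · S_{r+s} h`, because the shifts are multiplicative and form a
semigroup. The last factor ranges over all of `L²`, so its fibre need not be tracked. -/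
theorem mulShift_assoc {r s : ℝ≥0} (f : L2Sub P (sigmaPast L P r)) (g : L2Sub P (sigmaPast L P s))
    (h : Lp ℂ 2 P) : hL.mulShift hgen r f (hL.mulShift hgen s g h) =
      hL.mulShift hgen (r + s) (hL.mulFibre hgen r s f g) h := by
  refine Lp.ext ?_
  filter_upwards [hL.mulShift_ae_eq hgen f (hL.mulShift hgen s g h),
    hL.mulShift_ae_eq hgen (hL.mulFibre hgen r s f g) h, hL.mulShift_ae_eq hgen f (g : Lp ℂ 2 P),
    hL.shift_mul hgen r (hL.mulShift_ae_eq hgen g h)] with ω h1 h2 h3 h4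
  rw [h1, h2, mulFibre_coe, h3, h4, hL.shift_shift, mul_assoc]

theorem bundleMul_assoc {U : ∀ s t : PosTime,
    HilbertTensor (levyFibre L P s) (levyFibre L P t) ≃ₗᵢ[ℂ] levyFibre L P (s + t)}
    (hU : ∀ s t f g, (U s t (pureTensor f g) : Lp ℂ 2 P) = hL.mulShift hgen s f g)
    (a b c : TotalSpace (levyFibre L P)) :
    bundleMul U a (bundleMul U b c) = bundleMul U (bundleMul U a b) c := by
  -- The two products lie in fibres over `a + (b + c)` and `(a + b) + c`, which are distinct types;
  -- they are compared inside the common space `Lp ℂ 2 P`.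
  have hext : ∀ x y : TotalSpace (levyFibre L P), x.time = y.time →
      (x.vec : Lp ℂ 2 P) = y.vec → x = y := by
    rintro ⟨t, x⟩ ⟨_, y⟩ rfl h
    exact congrArg _ (Subtype.ext h)
  refine hext _ _ (add_assoc _ _ _).symm ?_
  simp only [bundleMul, hU]
  rw [mulShift_assoc]
  congr 2
  exact (Subtype.ext (hU _ _ _ _)).symm

end IsLevyProcess

/-! ### Measurable families of closed subspaces of a separable Hilbert space -/

section MeasurableField

open Submodule InnerProductSpace

variable {α H : Type*} [MeasurableSpace α] [NormedAddCommGroup H] [InnerProductSpace ℂ H]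
  [CompleteSpace H] [SecondCountableTopology H] [MeasurableSpace H] [BorelSpace H]

/-- Distinct basis vectors are at distance `√2`, so the balls of radius `1/2` around them are
disjoint. -/
theorem HilbertBasis.countable_index {H : Type*} [NormedAddCommGroup H] [InnerProductSpace ℂ H]
    [TopologicalSpace.SeparableSpace H] {ι : Type*}
    (b : HilbertBasis ι ℂ H) : Countable ι := by
  refine Pairwise.countable_of_isOpen_disjoint (s := fun i => Metric.ball (b i) (1 / 2)) ?_
    (fun i => Metric.isOpen_ball) fun i => ⟨b i, Metric.mem_ball_self (by norm_num)⟩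
  intro i j hij
  refine Metric.ball_disjoint_ball ?_
  have h : ‖b i - b j‖ ^ 2 = 2 := by
    rw [@norm_sub_sq ℂ, b.orthonormal.1 i, b.orthonormal.1 j, b.orthonormal.2 hij]
    norm_num
  rw [dist_eq_norm]
  nlinarith [norm_nonneg (b i - b j)]

/-- Measurability of a map to a separable Hilbert space can be tested weakly. -/
theorem measurable_of_measurable_inner {f : α → H}
    (h : ∀ d : H, Measurable fun a => inner ℂ d (f a)) : Measurable f := by
  obtain ⟨w, b, -⟩ := exists_hilbertBasis ℂ H
  have := b.countable_index
  refine measurable_of_tendsto_metrizable' (u := (atTop : Filter (Finset w)))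
    (f := fun s a => ∑ i ∈ s, b.repr (f a) i • b i) (fun s => ?_)
    (tendsto_pi_nhds.2 fun a => b.hasSum_repr (f a))
  refine Finset.measurable_fun_sum s fun i _ => Measurable.smul_const ?_ (b i)
  simpa only [b.repr_apply_apply] using h (b i)

/-- The vectors that test measurably form a closed subspace, so a total set of tests suffices. -/
theorem measurable_of_measurable_inner_of_span {f : α → H} (D : Set H)
    (hD : ∀ V : Submodule ℂ H, IsClosed (V : Set H) → D ⊆ V → V = ⊤)
    (h : ∀ d ∈ D, Measurable fun a => inner ℂ d (f a)) : Measurable f := by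
  refine measurable_of_measurable_inner fun d => ?_
  let V : Submodule ℂ H :=
    { carrier := {d | Measurable fun a => inner ℂ d (f a)}
      zero_mem' := by simp
      add_mem' := fun {x y} hx hy => by
        simp only [Set.mem_ofPred_eq, inner_add_left] at *
        exact hx.add hy
      smul_mem' := fun c x hx => by
        simp only [Set.mem_ofPred_eq, inner_smul_left] at *
        exact hx.const_mul _ }
  have hV : V = ⊤ := by
    refine hD V (IsSeqClosed.isClosed fun u x hu hx => ?_) h
    exact measurable_of_tendsto_metrizable hu
      (tendsto_pi_nhds.2 fun a => (hx.inner tendsto_const_nhds))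
  have : d ∈ V := hV ▸ Submodule.mem_top
  exact this

/-! ### Measurability of projections and of the graph. -/

variable (E : α → Submodule ℂ H) [∀ t, (E t).HasOrthogonalProjection]

/-- A family of closed subspaces is measurable when the projections depend measurably on the
parameter. -/
def IsMeasurableFamily : Prop := ∀ x, Measurable fun t => (E t).starProjection x

/-- Polarization: `⟨d, P x⟩ = ⟨P d, P x⟩` is a combination of squared norms of projections. -/
theorem isMeasurableFamily_of_measurable_norm
    (h : ∀ x, Measurable fun t => ‖(E t).starProjection x‖) : IsMeasurableFamily E := by
  intro x
  refine measurable_of_measurable_inner fun d => ?_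
  have h1 : ∀ t, inner ℂ d ((E t).starProjection x) =
      inner ℂ ((E t).starProjection d) ((E t).starProjection x) := fun t => by
    rw [inner_starProjection_left_eq_right, starProjection_apply,
      starProjection_eq_self_iff.2 (Subtype.mem _)]
  simp only [h1]
  simp only [inner_eq_sum_norm_sq_div_four, ← map_add, ← map_sub, ← map_smul]
  have h2 : ∀ x, Measurable fun t => ((‖(E t).starProjection x‖ : ℝ) : ℂ) := fun x =>
    Complex.measurable_ofReal.comp (h x)
  exact ((((h2 _).pow_const 2).sub ((h2 _).pow_const 2)).add
    ((((h2 _).pow_const 2).sub ((h2 _).pow_const 2)).mul_const _)).div_const _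

/-- For `s ≤ t` one has `P_s = P_s P_t`, so `‖P_t x‖` increases with `t`, and monotone functions are
Borel. -/
theorem isMeasurableFamily_of_monotone [LinearOrder α] [TopologicalSpace α] [OrderClosedTopology α]
    [BorelSpace α] (h : Monotone E) : IsMeasurableFamily E := by
  refine isMeasurableFamily_of_measurable_norm E fun x => Monotone.measurable fun s t hst => ?_
  rw [← starProjection_comp_starProjection_of_le (h hst)]
  exact norm_starProjection_apply_le _ _

variable {E}

/-- The graph is the set where `P_t x = x`, and `(t, x) ↦ P_t x` is jointly measurable, being
measurable in `t` and continuous in `x`. -/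
theorem IsMeasurableFamily.measurableSet (h : IsMeasurableFamily E) :
    MeasurableSet {q : α × H | q.2 ∈ E q.1} := by
  have h1 : Measurable fun q : α × H => (E q.1).starProjection q.2 := by
    have hu : Measurable (Function.uncurry fun (x : H) (t : α) => (E t).starProjection x) :=
      measurable_uncurry_of_continuous_of_measurable
        (fun t => ContinuousLinearMap.continuous _) h
    have := hu.comp measurable_swap
    simpa only [Function.comp_def, Function.uncurry, Prod.fst_swap, Prod.snd_swap] using this
  have h2 : {q : α × H | q.2 ∈ E q.1} = {q : α × H | (E q.1).starProjection q.2 = q.2} := by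
    ext q
    exact starProjection_eq_self_iff.symm
  rw [h2]
  exact measurableSet_eq_fun h1 measurable_snd

/-! ### Measurable orthonormal bases and trivialization. -/

omit [CompleteSpace H] in
theorem measurable_gramSchmidt {f : ℕ → α → H} (hf : ∀ k, Measurable (f k)) (k : ℕ) :
    Measurable fun t => gramSchmidt ℂ (fun j => f j t) k := by
  induction k using Nat.strong_induction_on with
  | _ k ih =>
    have hk : (fun t => gramSchmidt ℂ (fun j => f j t) k) = fun t => f k t - ∑ i ∈ Finset.Iio k,
      (ℂ ∙ gramSchmidt ℂ (fun j => f j t) i).starProjection (f k t) :=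
      funext fun t => gramSchmidt_def ℂ _ k
    rw [hk]
    refine (hf k).sub (Finset.measurable_fun_sum _ fun i hi => ?_)
    -- The explicit formula also covers a zero vector, where division by zero gives the zero
    -- projection.
    simp only [starProjection_singleton]
    have hi' := ih i (Finset.mem_Iio.1 hi)
    exact ((hi'.inner (hf k)).div
      (Complex.measurable_ofReal.comp (hi'.norm.pow_const 2))).smul hi'

omit [CompleteSpace H] in
theorem measurable_gramSchmidtNormed {f : ℕ → α → H} (hf : ∀ k, Measurable (f k)) (k : ℕ) :
    Measurable fun t => gramSchmidtNormed ℂ (fun j => f j t) k := by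
  have h := measurable_gramSchmidt hf k
  simp only [gramSchmidtNormed]
  exact Measurable.smul (Complex.measurable_ofReal.comp h.norm).inv h

/-- The `n`-th index is `k` exactly when `p t k` holds and `n` smaller indices satisfy `p t`. It
selects the nonzero Gram–Schmidt vectors measurably. -/
theorem measurable_nth {p : α → ℕ → Prop} (hp : ∀ k, MeasurableSet {t | p t k})
    (hinf : ∀ t, {k | p t k}.Infinite) (n : ℕ) : Measurable fun t => Nat.nth (p t) n := by
  classical
  have hcount : ∀ k, Measurable fun t => Nat.count (p t) k := by
    intro k
    induction k with
    | zero => simp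
    | succ k ih =>
      simp only [Nat.count_succ]
      exact ih.add (Measurable.ite (hp k) measurable_const measurable_const)
  refine measurable_to_countable' fun k => ?_
  have : (fun t => Nat.nth (p t) n) ⁻¹' {k} =
      {t | p t k} ∩ (fun t => Nat.count (p t) k) ⁻¹' {n} := by
    ext t
    simp only [Set.mem_preimage, Set.mem_singleton_iff, Set.mem_inter_iff, Set.mem_ofPred_eq]
    constructor
    · rintro rfl
      exact ⟨Nat.nth_mem_of_infinite (hinf t) n, Nat.count_nth_of_infinite (hinf t) n⟩
    · rintro ⟨h1, rfl⟩
      exact Nat.nth_count h1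
  rw [this]
  exact (hp k).inter (hcount k (measurableSet_singleton n))

theorem measurable_apply_of_countable {H : Type*} [MeasurableSpace H] {v : α → ℕ → H} (hv : ∀ k, Measurable fun t => v t k)
    {N : α → ℕ} (hN : Measurable N) : Measurable fun t => v t (N t) :=
  Measurable.comp (g := fun q : α × ℕ => v q.1 q.2) (measurable_from_prod_countable_left hv)
    (measurable_id.prodMk hN)

/-- A measurable family of infinite-dimensional closed subspaces has a measurable orthonormal
basis. -/
theorem IsMeasurableFamily.exists_basis (h : IsMeasurableFamily E)
    (hE : ∀ t, ¬ FiniteDimensional ℂ (E t)) :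
    ∃ e : ℕ → α → H, (∀ n, Measurable (e n)) ∧ (∀ t, Orthonormal ℂ fun n => e n t) ∧
      ∀ t, (span ℂ (Set.range fun n => e n t)).topologicalClosure = E t := by
  have hP : ∀ k, Measurable fun t => (E t).starProjection (TopologicalSpace.denseSeq H k) :=
    fun k => h _
  set v : α → ℕ → H := fun t =>
    gramSchmidtNormed ℂ fun k => (E t).starProjection (TopologicalSpace.denseSeq H k) with hv
  have hvm : ∀ k, Measurable fun t => v t k := fun k => measurable_gramSchmidtNormed hP k
  have hspan : ∀ t, (span ℂ (Set.range (v t))).topologicalClosure = E t := by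
    intro t
    have hcl : IsClosed (E t : Set H) :=
      orthogonal_orthogonal (E t) ▸ isClosed_orthogonal _
    refine le_antisymm ?_ ?_
    · refine topologicalClosure_minimal _ ?_ hcl
      rw [hv, span_gramSchmidtNormed_range, span_gramSchmidt, span_le]
      rintro _ ⟨k, rfl⟩
      exact starProjection_apply_mem _ _
    · intro x hx
      rw [hv, span_gramSchmidtNormed_range, span_gramSchmidt, ← starProjection_eq_self_iff.2 hx]
      refine closure_mono subset_span ?_
      rw [Set.range_comp' (g := (E t).starProjection)]
      exact image_closure_subset_closure_image (E t).starProjection.continuous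
        ⟨x, (TopologicalSpace.denseRange_denseSeq H) x, rfl⟩
  have hinf : ∀ t, {k | v t k ≠ 0}.Infinite := by
    intro t hfin
    refine hE t ?_
    have h1 : span ℂ (Set.range (v t)) = span ℂ (v t '' {k | v t k ≠ 0}) := by
      refine le_antisymm (span_le.2 ?_) (span_mono (Set.image_subset_range _ _))
      rintro _ ⟨k, rfl⟩
      by_cases hk : v t k = 0
      · rw [hk]; exact zero_mem _
      · exact subset_span ⟨k, hk, rfl⟩
    have h2 : FiniteDimensional ℂ (span ℂ (Set.range (v t))) := by
      rw [h1]
      exact FiniteDimensional.span_of_finite ℂ (hfin.image _)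
    rw [← hspan t, (closed_of_finiteDimensional _).submodule_topologicalClosure_eq]
    exact h2
  have hnth := measurable_nth (fun k => (measurableSet_eq_fun (hvm k) measurable_const).compl) hinf
  -- Gram–Schmidt yields `0` at each redundant vector; enumerating the nonzero ones leaves an
  -- orthonormal sequence with the same span.
  refine ⟨fun n t => v t (Nat.nth (fun k => v t k ≠ 0) n), fun n => ?_, fun t => ?_, fun t => ?_⟩
  · exact measurable_apply_of_countable hvm (hnth n)
  · have ho := gramSchmidtNormed_orthonormal' (𝕜 := ℂ)
      fun k => (E t).starProjection (TopologicalSpace.denseSeq H k)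
    exact ho.comp (fun n => ⟨_, Nat.nth_mem_of_infinite (hinf t) n⟩) fun m n hmn =>
      Nat.nth_injective (hinf t) (congrArg Subtype.val hmn)
  · rw [← hspan t]
    congr 1
    refine le_antisymm (span_mono ?_) (span_le.2 ?_)
    · rintro _ ⟨n, rfl⟩
      exact ⟨_, rfl⟩
    · rintro _ ⟨k, rfl⟩
      by_cases hk : v t k = 0
      · rw [hk]; exact zero_mem _
      · have : k ∈ Set.range (Nat.nth fun k => v t k ≠ 0) := by
          rw [Nat.range_nth_of_infinite (hinf t)]; exact hk
        obtain ⟨n, rfl⟩ := this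
        exact subset_span ⟨n, rfl⟩

/-- The standard Hilbert basis of `ℓ²(ℕ)`. -/
noncomputable def ell2Basis : HilbertBasis ℕ ℂ Ell2 := HilbertBasis.ofRepr (.refl ℂ Ell2)

theorem secondCountableTopology_ell2 : SecondCountableTopology Ell2 := by
  have h : TopologicalSpace.IsSeparable (Set.univ : Set Ell2) := by
    have := ((Set.countable_range ell2Basis).isSeparable.span (R := ℂ)).closure
    rwa [← topologicalClosure_coe, ell2Basis.dense_span] at this
  have := TopologicalSpace.isSeparable_univ_iff.1 h
  exact UniformSpace.secondCountable_of_separable Ell2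

/-- A measurable family of infinite-dimensional closed subspaces is measurably isomorphic to the
constant family `ℓ²(ℕ)`. -/
theorem IsMeasurableFamily.exists_trivialization (h : IsMeasurableFamily E)
    (hE : ∀ t, ¬ FiniteDimensional ℂ (E t)) :
    ∃ V : ∀ t, E t ≃ₗᵢ[ℂ] Ell2, ∀ (β : Type _) (_ : MeasurableSpace β) (τ : β → α)
      (x : ∀ b, E (τ b)), Measurable τ → Measurable (fun b => (x b : H)) →
        Measurable fun b => V (τ b) (x b) := by
  obtain ⟨e, hem, heo, hes⟩ := h.exists_basis hE
  have hmem : ∀ t n, e n t ∈ E t := fun t n =>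
    hes t ▸ le_topologicalClosure _ (subset_span ⟨n, rfl⟩)
  have ho : ∀ t, Orthonormal ℂ fun n => (⟨e n t, hmem t n⟩ : E t) := fun t =>
    ⟨fun n => (heo t).1 n, fun m n hmn => (heo t).2 hmn⟩
  have hbot : ∀ t, (span ℂ (Set.range fun n => (⟨e n t, hmem t n⟩ : E t)))ᗮ = ⊥ := by
    intro t
    refine eq_bot_iff.2 fun x hx => ?_
    have h1 : (x : H) ∈ (span ℂ (Set.range fun n => e n t))ᗮ := by
      rw [mem_orthogonal'] at hx ⊢
      intro u hu
      have hle : span ℂ (Set.range fun n => e n t) ≤ LinearMap.ker (innerSL ℂ (x : H)).toLinearMap := by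
        rw [span_le]
        rintro _ ⟨n, rfl⟩
        exact hx _ (subset_span ⟨n, rfl⟩)
      exact hle hu
    rw [← orthogonal_closure, hes t] at h1
    have h2 : inner ℂ (x : H) (x : H) = 0 := (mem_orthogonal _ _).1 h1 _ x.2
    exact (mem_bot ℂ).2 (Subtype.ext (inner_self_eq_zero.1 h2))
  have hc : ∀ t, CompleteSpace (E t) := fun t =>
    (orthogonal_orthogonal (E t) ▸ isClosed_orthogonal _ : IsClosed (E t : Set H)).completeSpace_coe
  have := secondCountableTopology_ell2
  refine ⟨fun t => (HilbertBasis.mkOfOrthogonalEqBot (ho t) (hbot t)).repr,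
    fun β _ τ x hτ hx => ?_⟩
  refine measurable_of_measurable_inner_of_span (Set.range ell2Basis) (fun V hV hD => ?_) ?_
  · have h1 := topologicalClosure_minimal _ (span_le.2 hD) hV
    rw [ell2Basis.dense_span] at h1
    exact top_le_iff.1 h1
  · rintro _ ⟨n, rfl⟩
    -- The `n`-th coordinate of the image is the inner product with the measurable basis vector `e
    -- n`.
    have h1 : ∀ b, inner ℂ (ell2Basis n)
        ((HilbertBasis.mkOfOrthogonalEqBot (ho (τ b)) (hbot (τ b))).repr (x b)) =
        inner ℂ (e n (τ b)) (x b : H) := by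
      intro b
      have h2 := (HilbertBasis.mkOfOrthogonalEqBot (ho (τ b)) (hbot (τ b))).repr_apply_apply (x b) n
      rw [HilbertBasis.coe_mkOfOrthogonalEqBot] at h2
      exact (ell2Basis.repr_apply_apply _ n).symm.trans h2
    simp only [h1]
    exact ((hem n).comp hτ).inner hx

end MeasurableField

theorem MeasurableEmbedding.standardBorelSpace {α β : Type*} [MeasurableSpace α]
    [MeasurableSpace β] [StandardBorelSpace β] {f : α → β} (hf : MeasurableEmbedding f) :
    StandardBorelSpace α := by
  obtain ⟨τ, hb, hp⟩ := hf.measurableSet_range.standardBorel.polish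
  let e := hf.equivRange
  let _ : TopologicalSpace α := τ.induced e
  have hα : BorelSpace α := by
    refine ⟨?_⟩
    have h : ∀ m, m = borel (Set.range f) → m.comap e = borel α := by
      rintro _ rfl
      exact borel_comap.symm
    exact e.measurableEmbedding.comap_eq.symm.trans (h _ hb.measurable_eq)

  exact ⟨_, hα, e.toEquiv.polishSpace_induced⟩

/-! ### The Borel structure of the bundle -/

namespace IsLevyProcess

set_option linter.unusedSectionVars false

variable {Ω B : Type*} [NormedAddCommGroup B] [CompleteSpace B] [SecondCountableTopology B]
  [MeasurableSpace B] [BorelSpace B]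
  [mΩ : MeasurableSpace Ω] {P : Measure Ω} [IsProbabilityMeasure P] {L : ℝ≥0 → Ω → B}

theorem measurable_totalSpace_iff {β : Type*} [MeasurableSpace β]
    {f : β → TotalSpace (levyFibre L P)} :
    Measurable f ↔ Measurable (fun b => (f b).time) ∧
      Measurable (fun b => ((f b).vec : Lp ℂ 2 P)) := by
  rw [measurable_comap_iff]
  exact ⟨fun h => ⟨h.fst, h.snd⟩, fun h => h.1.prodMk h.2⟩

theorem measurable_time : Measurable (TotalSpace.time : TotalSpace (levyFibre L P) → PosTime) :=
  (measurable_totalSpace_iff.1 measurable_id).1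

theorem measurable_vec :
    Measurable (fun x : TotalSpace (levyFibre L P) => (x.vec : Lp ℂ 2 P)) :=
  (measurable_totalSpace_iff.1 measurable_id).2

theorem measurable_fibrePairs_left :
    Measurable fun q : FibrePairs (levyFibre L P) =>
      (⟨q.time, q.left⟩ : TotalSpace (levyFibre L P)) :=
  measurable_fst.comp (comap_measurable
    (fun q : FibrePairs (levyFibre L P) => ((⟨q.time, q.left⟩, ⟨q.time, q.right⟩) :
      TotalSpace (levyFibre L P) × TotalSpace (levyFibre L P))))

theorem measurable_fibrePairs_right :
    Measurable fun q : FibrePairs (levyFibre L P) =>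
      (⟨q.time, q.right⟩ : TotalSpace (levyFibre L P)) :=
  measurable_snd.comp (comap_measurable
    (fun q : FibrePairs (levyFibre L P) => ((⟨q.time, q.left⟩, ⟨q.time, q.right⟩) :
      TotalSpace (levyFibre L P) × TotalSpace (levyFibre L P))))

theorem totalSpace_ext {x y : TotalSpace (levyFibre L P)} (h : x.time = y.time)
    (h' : (x.vec : Lp ℂ 2 P) = y.vec) : x = y := by
  obtain ⟨t, x⟩ := x
  obtain ⟨_, y⟩ := y
  obtain rfl : t = _ := h
  exact congrArg _ (Subtype.ext h')

variable (hL : IsLevyProcess L P) (hgen : mΩ = sigmaAll L)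

include hL

theorem completeSpace_levyFibre (t : PosTime) : CompleteSpace (levyFibre L P t) :=
  (isClosed_L2Sub (P := P) (hL.sigmaPast_le _)).completeSpace_coe

include hgen

theorem secondCountableTopology_L2 : SecondCountableTopology (Lp ℂ 2 P) :=
  have := hL.separableSpace_L2 hgen
  UniformSpace.secondCountable_of_separable _

theorem isMeasurableFamily_levyFibre
    [∀ t : PosTime, (L2Sub P (sigmaPast L P t)).HasOrthogonalProjection] :
    IsMeasurableFamily fun t : PosTime => L2Sub P (sigmaPast L P t) := by
  have := hL.secondCountableTopology_L2 hgen
  refine isMeasurableFamily_of_monotone _ fun s t hst f hf => ?_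
  exact mem_lpMeas_iff_aestronglyMeasurable.2
    ((mem_lpMeas_iff_aestronglyMeasurable.1 hf).mono (sigmaPast_mono L P hst))

/-- The range is the graph of the measurable family of fibres, hence a Borel set. -/
theorem measurableEmbedding_totalSpace : MeasurableEmbedding
    (fun x => ((x.time, (x.vec : Lp ℂ 2 P)) : PosTime × Lp ℂ 2 P) :
      TotalSpace (levyFibre L P) → PosTime × Lp ℂ 2 P) := by
  have := hL.secondCountableTopology_L2 hgen
  have := hL.completeSpace_levyFibre
  have hr : MeasurableSet (Set.range (fun x => ((x.time, (x.vec : Lp ℂ 2 P)) : PosTime × Lp ℂ 2 P) :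
      TotalSpace (levyFibre L P) → PosTime × Lp ℂ 2 P)) := by
    convert (hL.isMeasurableFamily_levyFibre hgen).measurableSet using 1
    ext q
    constructor
    · rintro ⟨x, rfl⟩
      exact x.vec.2
    · intro hq
      exact ⟨⟨q.1, ⟨q.2, hq⟩⟩, rfl⟩
  refine ⟨fun x y hxy => totalSpace_ext (congrArg Prod.fst hxy) (congrArg Prod.snd hxy),
    measurable_time.prodMk measurable_vec, fun s hs => ?_⟩
  obtain ⟨t, ht, rfl⟩ := hs
  rw [Set.image_preimage_eq_inter_range]
  exact ht.inter hr

theorem standardBorelSpace_totalSpace : StandardBorelSpace (TotalSpace (levyFibre L P)) := by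
  have := hL.secondCountableTopology_L2 hgen
  have : StandardBorelSpace PosTime := (measurableSet_Ioi (a := (0 : ℝ≥0))).standardBorel
  exact (hL.measurableEmbedding_totalSpace hgen).standardBorelSpace

/-- By Lusin–Souslin, an injective Borel map between standard Borel spaces is an embedding. -/
theorem measurableEmbedding_mk (t : PosTime) :
    @MeasurableEmbedding (levyFibre L P t) (TotalSpace (levyFibre L P)) (borel _) _
      (TotalSpace.mk t) := by
  have := hL.secondCountableTopology_L2 hgen
  have := hL.completeSpace_levyFibre t
  have := hL.standardBorelSpace_totalSpace hgen
  let _ : MeasurableSpace (levyFibre L P t) := borel _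
  have : BorelSpace (levyFibre L P t) := ⟨rfl⟩
  refine Measurable.measurableEmbedding ?_ fun x y hxy => ?_
  · exact measurable_totalSpace_iff.2 ⟨measurable_const, continuous_subtype_val.measurable⟩
  · simpa using hxy

/-- Multiplication is continuous from `L² × L²` to `L¹`, so `∫_A f · S_s g` makes sense and is
continuous for all `f`, `g`, without the dependence of the domain of `f` on `s`. -/
theorem continuous_inner_indL2_mulShift {A : Set Ω} (hA : MeasurableSet A) :
    ∃ F : ℝ≥0 × Lp ℂ 2 P × Lp ℂ 2 P → ℂ, Continuous F ∧
      ∀ (s : ℝ≥0) (f : L2Sub P (sigmaPast L P s)) (g : Lp ℂ 2 P),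
        F (s, f, g) = inner ℂ (indL2 P hA) (hL.mulShift hgen s f g) := by
  obtain ⟨T, hT⟩ : ∃ T : Lp ℂ 2 P →L[ℂ] Lp ℂ 2 P →L[ℂ] Lp ℂ 1 P,
      ∀ f g, T f g =ᵐ[P] fun ω => f ω * g ω :=
    ⟨(ContinuousLinearMap.mul ℂ ℂ).holderL P 2 2 1,
      (ContinuousLinearMap.mul ℂ ℂ).coeFn_holder (r := 1)⟩
  obtain ⟨S, hSc, hS⟩ : ∃ S : ℝ≥0 × Lp ℂ 2 P → Lp ℂ 2 P, Continuous S ∧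
      ∀ s g, S (s, g) = hL.shift hgen s g := ⟨_, hL.continuous_shift hgen, fun _ _ => rfl⟩
  refine ⟨fun q => ∫ ω in A, T q.2.1 (S (q.1, q.2.2)) ω ∂P, ?_, fun s f g => ?_⟩
  · have hc := T.continuous₂.comp ((continuous_fst.comp continuous_snd).prodMk
      (hSc.comp (continuous_fst.prodMk (continuous_snd.comp continuous_snd))))
    exact (continuous_setIntegral (μ := P) (E := ℂ) A).comp hc
  · rw [L2.inner_indicatorConstLp_one]
    dsimp only
    rw [hS]
    refine setIntegral_congr_ae hA ?_
    filter_upwards [hT f (hL.shift hgen s g), hL.mulShift_ae_eq hgen f g] with ω h1 h2 _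
    rw [h2]
    exact h1

/-- Measurability is tested against indicators, which are total in `L²`; each test is a continuous
function of `(s, f, g)`. -/
theorem measurable_bundleMul {U : ∀ s t : PosTime,
    HilbertTensor (levyFibre L P s) (levyFibre L P t) ≃ₗᵢ[ℂ] levyFibre L P (s + t)}
    (hU : ∀ s t f g, (U s t (pureTensor f g) : Lp ℂ 2 P) = hL.mulShift hgen s f g) :
    Measurable fun q : TotalSpace (levyFibre L P) × TotalSpace (levyFibre L P) =>
      bundleMul U q.1 q.2 := by
  have := hL.secondCountableTopology_L2 hgen
  refine measurable_totalSpace_iff.2 ⟨?_, ?_⟩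
  · have h1 : Measurable fun q : TotalSpace (levyFibre L P) × TotalSpace (levyFibre L P) =>
        ((q.1.time : ℝ≥0) + q.2.time) :=
      (measurable_subtype_coe.comp (measurable_time.comp measurable_fst)).add
        (measurable_subtype_coe.comp (measurable_time.comp measurable_snd))
    exact h1.subtype_mk
  · simp only [bundleMul, hU]
    refine measurable_of_measurable_inner_of_span
      {d | ∃ (A : Set Ω) (hA : MeasurableSet A), d = indL2 P hA} (fun V hV hD => ?_) ?_
    · refine top_le_iff.1 fun f _ => ?_
      have hle : L2Sub P mΩ ≤ V := by
        refine L2Sub_le (Y := id) measurable_id le_rfl ?_ hV fun C hC => hD ⟨_, _, rfl⟩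
        rw [MeasurableSpace.comap_id]
        exact fun s hs => MeasurableSet.eventuallyMeasurableSet hs
      exact hle (mem_lpMeas_iff_aestronglyMeasurable.2 (Lp.aestronglyMeasurable f))
    · rintro _ ⟨A, hA, rfl⟩
      obtain ⟨F, hF, hFe⟩ := hL.continuous_inner_indL2_mulShift hgen hA
      simp only [← hFe]
      exact hF.measurable.comp ((measurable_subtype_coe.comp (measurable_time.comp
        measurable_fst)).prodMk ((measurable_vec.comp measurable_fst).prodMk
          (measurable_vec.comp measurable_snd)))

theorem isMultiplicativeBundle {U : ∀ s t : PosTime,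
    HilbertTensor (levyFibre L P s) (levyFibre L P t) ≃ₗᵢ[ℂ] levyFibre L P (s + t)}
    (hU : ∀ s t f g, (U s t (pureTensor f g) : Lp ℂ 2 P) = hL.mulShift hgen s f g) :
    IsMultiplicativeBundle U := by
  have := hL.secondCountableTopology_L2 hgen
  have hl := measurable_vec.comp (measurable_fibrePairs_left (L := L) (P := P))
  have hr := measurable_vec.comp (measurable_fibrePairs_right (L := L) (P := P))
  have ht : Measurable fun q : FibrePairs (levyFibre L P) => q.time :=
    measurable_time.comp measurable_fibrePairs_left
  have ht' : Measurable fun q : ℂ × TotalSpace (levyFibre L P) => q.2.time :=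
    measurable_time.comp measurable_snd
  exact
    { complete := hL.completeSpace_levyFibre
      separable := fun t => inferInstance
      standardBorel := hL.standardBorelSpace_totalSpace hgen
      measurable_time := measurable_time
      fibre_embedding := hL.measurableEmbedding_mk hgen
      measurable_smul := measurable_totalSpace_iff.2
        ⟨ht', measurable_fst.smul (measurable_vec.comp measurable_snd)⟩
      measurable_add := measurable_totalSpace_iff.2
        ⟨ht, hl.add hr⟩
      measurable_inner := hl.inner hr
      measurable_mul := hL.measurable_bundleMul hgen hU
      assoc := hL.bundleMul_assoc hgen hU }

end IsLevyProcess

/-! ### Exponential units -/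

namespace IsLevyProcess

set_option linter.unusedSectionVars false

variable {Ω B : Type*} [NormedAddCommGroup B] [CompleteSpace B] [SecondCountableTopology B]
  [MeasurableSpace B] [BorelSpace B] [NormedSpace ℝ B]
  [mΩ : MeasurableSpace Ω] {P : Measure Ω} [IsProbabilityMeasure P] {L : ℝ≥0 → Ω → B}

/-- The character `x ↦ exp(i⟨φ, x⟩)`. -/
noncomputable def dualChar (φ : StrongDual ℝ B) (x : B) : ℂ :=
  Complex.exp (Complex.I * ((φ x : ℝ) : ℂ))

theorem continuous_dualChar (φ : StrongDual ℝ B) : Continuous (dualChar φ) := by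
  unfold dualChar
  fun_prop

theorem measurable_dualChar (φ : StrongDual ℝ B) : Measurable (dualChar φ) :=
  (continuous_dualChar φ).measurable

theorem norm_dualChar (φ : StrongDual ℝ B) (x : B) : ‖dualChar φ x‖ = 1 := by
  rw [dualChar, mul_comm]
  exact Complex.norm_exp_ofReal_mul_I _

theorem dualChar_add (φ : StrongDual ℝ B) (x y : B) :
    dualChar φ (x + y) = dualChar φ x * dualChar φ y := by
  simp only [dualChar, map_add, Complex.ofReal_add, mul_add, Complex.exp_add]

theorem dualChar_zero (φ : StrongDual ℝ B) : dualChar φ 0 = 1 := by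
  simp [dualChar]

variable (hL : IsLevyProcess L P) (hgen : mΩ = sigmaAll L) (φ : StrongDual ℝ B)

include hL in
theorem memLp_dualChar (t : ℝ≥0) : MemLp (fun ω => dualChar φ (L t ω)) 2 P :=
  MemLp.of_bound ((measurable_dualChar φ).comp (hL.measurable t)).aestronglyMeasurable 1
    (Eventually.of_forall fun _ => (norm_dualChar φ _).le)

/-- The exponential `exp(i⟨φ, L_t⟩)` as an element of `L²`. -/
noncomputable def expL2 (t : ℝ≥0) : Lp ℂ 2 P := (hL.memLp_dualChar φ t).toLp _

theorem expL2_ae_eq (t : ℝ≥0) : hL.expL2 φ t =ᵐ[P] fun ω => dualChar φ (L t ω) :=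
  (hL.memLp_dualChar φ t).coeFn_toLp

theorem expL2_mem (t : ℝ≥0) : hL.expL2 φ t ∈ L2Sub P (sigmaPast L P t) := by
  refine mem_lpMeas_iff_aestronglyMeasurable.2 (AEStronglyMeasurable.congr ?_
    (hL.expL2_ae_eq φ t).symm)
  have h : Measurable[sigmaPast L P t] (L t) := Measurable.mono (comap_measurable _)
    (le_sup_of_le_left (le_iSup_of_le (⟨t, Set.mem_Iic.2 le_rfl⟩ : Set.Iic t) le_rfl)) le_rfl
  exact ((measurable_dualChar φ).comp h).aestronglyMeasurable

theorem norm_expL2 (t : ℝ≥0) : ‖hL.expL2 φ t‖ = 1 := by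
  rw [expL2, Lp.norm_toLp, eLpNorm_congr_norm_ae (g := fun _ => (1 : ℂ))
    (Eventually.of_forall fun ω => by rw [norm_dualChar, norm_one]),
    eLpNorm_const _ (by norm_num) (IsProbabilityMeasure.ne_zero P)]
  simp

theorem shift_expL2 (s t : ℝ≥0) :
    hL.shift hgen s (hL.expL2 φ t) =ᵐ[P] fun ω => dualChar φ (L (s + t) ω - L s ω) := by
  refine hL.shift_ae_eq hgen s (T := Set.Iic t)
    (h := fun x => dualChar φ (x ⟨t, Set.mem_Iic.2 le_rfl⟩))
    ((measurable_dualChar φ).comp (measurable_pi_apply _)) ?_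
  filter_upwards [hL.expL2_ae_eq φ t, hL.zero] with ω h1 h2
  rw [h1]
  simp [incrPath, h2]

theorem mulShift_expL2 (s t : ℝ≥0) :
    hL.mulShift hgen s ⟨hL.expL2 φ s, hL.expL2_mem φ s⟩ (hL.expL2 φ t) = hL.expL2 φ (s + t) := by
  refine Lp.ext ?_
  filter_upwards [hL.mulShift_ae_eq hgen ⟨hL.expL2 φ s, hL.expL2_mem φ s⟩ (hL.expL2 φ t),
    hL.expL2_ae_eq φ s, hL.expL2_ae_eq φ (s + t), hL.shift_expL2 hgen φ s t] with ω h1 h2 h3 h4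
  rw [h1, h2, h3, h4, ← dualChar_add, add_sub_cancel]

include hgen in
-- The difference factors as `e_s · S_s (e_t - e_0)`, norms multiply, and `e_s` has norm one.
-- Continuity of the unit is thus reduced to time `0`.
theorem norm_expL2_sub (s t : ℝ≥0) :
    ‖hL.expL2 φ (s + t) - hL.expL2 φ s‖ = ‖hL.expL2 φ t - hL.expL2 φ 0‖ := by
  have h : hL.expL2 φ (s + t) - hL.expL2 φ s = hL.mulShift hgen s
      ⟨hL.expL2 φ s, hL.expL2_mem φ s⟩ (hL.expL2 φ t - hL.expL2 φ 0) := by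
    rw [map_sub, mulShift_expL2, mulShift_expL2, add_zero]
  rw [h, norm_mulShift, Submodule.coe_norm, norm_expL2, one_mul]

theorem tendsto_expL2 : Tendsto (hL.expL2 φ) (𝓝 0) (𝓝 (hL.expL2 φ 0)) := by
  have h1 : ∀ t, inner ℂ (hL.expL2 φ 0) (hL.expL2 φ t) = ∫ ω, dualChar φ (L t ω) ∂P := by
    intro t
    rw [L2.inner_def]
    refine integral_congr_ae ?_
    filter_upwards [hL.expL2_ae_eq φ t, hL.expL2_ae_eq φ 0, hL.zero] with ω h1 h2 h3
    rw [h1, h2, h3, dualChar_zero]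
    simp
  have h2 : Tendsto (fun t => ∫ ω, dualChar φ (L t ω) ∂P) (𝓝 0)
      (𝓝 (∫ ω, dualChar φ (L 0 ω) ∂P)) := by
    refine tendsto_integral_filter_of_dominated_convergence (fun _ => 1)
      (Eventually.of_forall fun t =>
        ((measurable_dualChar φ).comp (hL.measurable t)).aestronglyMeasurable)
      (Eventually.of_forall fun t => Eventually.of_forall fun ω => (norm_dualChar φ _).le)
      (integrable_const _) ?_
    filter_upwards [hL.cadlag] with ω hω
    have h := (hω 0).1.tendsto
    -- At the least time, right-continuity is continuity.
    have hu : Set.Ici (0 : ℝ≥0) = Set.univ := Set.Ici_bot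
    rw [hu, nhdsWithin_univ] at h
    exact ((continuous_dualChar φ).tendsto _).comp h
  simp only [← h1] at h2
  have hself : (inner ℂ (hL.expL2 φ 0) (hL.expL2 φ 0) : ℂ).re = 1 := by
    have := inner_self_eq_norm_sq (𝕜 := ℂ) (hL.expL2 φ 0)
    rw [norm_expL2, one_pow] at this
    exact this
  have hre := (Complex.continuous_re.tendsto _).comp h2
  rw [hself] at hre
  have hsq : ∀ t, ‖hL.expL2 φ t - hL.expL2 φ 0‖ ^ 2 =
      2 - 2 * (inner ℂ (hL.expL2 φ 0) (hL.expL2 φ t)).re := by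
    intro t
    rw [@norm_sub_sq ℂ, norm_expL2, norm_expL2, ← inner_conj_symm]
    simp only [RCLike.conj_re, RCLike.re_to_complex]
    ring
  rw [tendsto_iff_norm_sub_tendsto_zero]
  have hlim : Tendsto (fun t => ‖hL.expL2 φ t - hL.expL2 φ 0‖ ^ 2) (𝓝 0) (𝓝 0) := by
    simp_rw [hsq]
    have := (tendsto_const_nhds (x := (2 : ℝ))).sub (hre.const_mul 2)
    simpa using! this
  have := (Real.continuous_sqrt.tendsto _).comp hlim
  simpa [Function.comp_def, Real.sqrt_sq] using this

include hgen in
theorem continuous_expL2 : Continuous (hL.expL2 φ) := by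
  have h0 := tendsto_iff_norm_sub_tendsto_zero.1 (hL.tendsto_expL2 φ)
  have hn : ∀ a b, ‖hL.expL2 φ a - hL.expL2 φ b‖ =
      ‖hL.expL2 φ (nndist a b) - hL.expL2 φ 0‖ := by
    intro a b
    wlog h : b ≤ a generalizing a b
    · rw [norm_sub_rev, this b a (le_of_not_ge h), nndist_comm]
    · have : a = b + nndist a b := by
        rw [NNReal.nndist_eq, tsub_eq_zero_of_le h, max_eq_left zero_le, add_tsub_cancel_of_le h]
      conv_lhs => rw [this]
      exact hL.norm_expL2_sub hgen φ b _
  refine continuous_iff_continuousAt.2 fun a => tendsto_iff_norm_sub_tendsto_zero.2 ?_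
  refine Tendsto.congr (fun b => (hn b a).symm) (h0.comp ?_)
  have : Continuous fun b : ℝ≥0 => nndist b a := by fun_prop
  simpa using this.tendsto a

theorem isProductUnit_expL2 {U : ∀ s t : PosTime,
    HilbertTensor (levyFibre L P s) (levyFibre L P t) ≃ₗᵢ[ℂ] levyFibre L P (s + t)}
    (hU : ∀ s t f g, (U s t (pureTensor f g) : Lp ℂ 2 P) = hL.mulShift hgen s f g) :
    IsProductUnit U fun t : PosTime =>
      (⟨hL.expL2 φ t, hL.expL2_mem φ t⟩ : levyFibre L P t) := by
  have hc : Measurable fun t : PosTime => hL.expL2 φ t :=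
    (hL.continuous_expL2 hgen φ).measurable.comp measurable_subtype_coe
  have h1 : (⟨hL.expL2 φ (1 : ℝ≥0), hL.expL2_mem φ 1⟩ : L2Sub P (sigmaPast L P 1)) ≠ 0 := by
    intro h
    have h' := hL.norm_expL2 φ 1
    rw [show hL.expL2 φ 1 = 0 from congrArg Subtype.val h, norm_zero] at h'
    exact zero_ne_one h'
  have hm : ∀ s t : PosTime, hL.expL2 φ ((s + t : PosTime) : ℝ≥0) =
      U s t (pureTensor ⟨hL.expL2 φ s, hL.expL2_mem φ s⟩ ⟨hL.expL2 φ t, hL.expL2_mem φ t⟩) := by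
    intro s t
    rw [hU]
    exact (hL.mulShift_expL2 hgen φ s t).symm
  exact ⟨measurable_totalSpace_iff.2 ⟨measurable_id, hc⟩, ⟨⟨1, one_pos⟩, h1⟩,
    fun s t => Subtype.ext (hm s t)⟩

end IsLevyProcess

/-! ### Dimension of the fibres -/

/-- The algebraic tensor product, whose dimension is the product, embeds isometrically in its
completion. -/
theorem finrank_mul_finrank_le_of_hilbertTensor {H K M : Type*} [NormedAddCommGroup H]
    [InnerProductSpace ℂ H] [NormedAddCommGroup K] [InnerProductSpace ℂ K] [NormedAddCommGroup M]
    [InnerProductSpace ℂ M] [FiniteDimensional ℂ M] (U : HilbertTensor H K ≃ₗᵢ[ℂ] M) :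
    Module.finrank ℂ H * Module.finrank ℂ K ≤ Module.finrank ℂ M := by
  rw [← Module.finrank_tensorProduct (R := ℂ) (S := ℂ)]
  let J : H ⊗[ℂ] K →ₗᵢ[ℂ] M := U.toLinearIsometry.comp UniformSpace.Completion.toComplₗᵢ
  exact LinearMap.finrank_le_finrank_of_injective (f := J.toLinearMap) J.injective

namespace IsLevyProcess

set_option linter.unusedSectionVars false

variable {Ω B : Type*} [NormedAddCommGroup B] [CompleteSpace B] [SecondCountableTopology B]
  [MeasurableSpace B] [BorelSpace B]
  [mΩ : MeasurableSpace Ω] {P : Measure Ω} [IsProbabilityMeasure P] {L : ℝ≥0 → Ω → B}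

theorem L2Sub_sigmaPast_mono {s t : ℝ≥0} (h : s ≤ t) :
    L2Sub P (sigmaPast L P s) ≤ L2Sub P (sigmaPast L P t) := fun _ hf =>
  mem_lpMeas_iff_aestronglyMeasurable.2
    ((mem_lpMeas_iff_aestronglyMeasurable.1 hf).mono (sigmaPast_mono L P h))

variable (hL : IsLevyProcess L P) (hgen : mΩ = sigmaAll L)

include hL

/-- The constant `1` lies in the fibre, so dimension at most one makes every indicator of `L r ⁻¹'
C` a.e. constant. The law of `L r` is then zero-one valued, hence a Dirac mass. -/
theorem exists_ae_eq_of_finrank_le_one {r : ℝ≥0}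
    [FiniteDimensional ℂ (L2Sub P (sigmaPast L P r))]
    (h : Module.finrank ℂ (L2Sub P (sigmaPast L P r)) ≤ 1) : ∃ b : B, ∀ᵐ ω ∂P, L r ω = b := by
  obtain ⟨v, hv⟩ := finrank_le_one_iff.1 h
  have hLr : Measurable[sigmaPast L P r] (L r) := Measurable.mono (comap_measurable _)
    (le_sup_of_le_left (le_iSup_of_le (⟨r, Set.mem_Iic.2 le_rfl⟩ : Set.Iic r) le_rfl)) le_rfl
  have hconst : ∀ C : Set B, ∀ hC : MeasurableSet C, ∃ c : ℂ,
      ∀ᵐ ω ∂P, (L r ⁻¹' C).indicator (fun _ => (1 : ℂ)) ω = c := by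
    intro C hC
    obtain ⟨c₁, hc₁⟩ := hv ⟨indL2 P MeasurableSet.univ,
      indL2_mem_L2Sub MeasurableSet.univ MeasurableSet.univ⟩
    obtain ⟨c, hc⟩ := hv ⟨indL2 P (hL.measurable r hC),
      indL2_mem_L2Sub (hL.measurable r hC) (hLr hC)⟩
    have hc₁' : c₁ • (v : Lp ℂ 2 P) = indL2 P MeasurableSet.univ := congrArg Subtype.val hc₁
    have hc' : c • (v : Lp ℂ 2 P) = indL2 P (hL.measurable r hC) := congrArg Subtype.val hc
    refine ⟨c / c₁, ?_⟩
    filter_upwards [indL2_coeFn (P := P) (hL.measurable r hC),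
      indL2_coeFn (P := P) (MeasurableSet.univ : MeasurableSet (Set.univ : Set Ω)),
      Lp.coeFn_smul c₁ (v : Lp ℂ 2 P), Lp.coeFn_smul c (v : Lp ℂ 2 P)] with ω h1 h2 h3 h4
    rw [hc₁', h2, Set.indicator_univ, Pi.smul_apply, smul_eq_mul] at h3
    rw [hc', h1, Pi.smul_apply, smul_eq_mul] at h4
    have h5 : c₁ ≠ 0 := left_ne_zero_of_mul (h3 ▸ one_ne_zero)
    rw [h4, eq_div_iff h5, mul_assoc, mul_comm _ c₁, ← h3, mul_one]
  have hp := Measure.isProbabilityMeasure_map (μ := P) (hL.measurable r).aemeasurable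
  have hzo : IsZeroOneMeasure (P.map (L r)) := by
    refine ⟨fun C hC => ?_⟩
    rw [Measure.map_apply (hL.measurable r) hC]
    obtain ⟨c, hc⟩ := hconst C hC
    by_cases h1 : c = 1
    · refine Or.inr ((prob_compl_eq_zero_iff (hL.measurable r hC)).1 ?_)
      refine measure_eq_zero_iff_ae_notMem.2 ?_
      filter_upwards [hc] with ω hω hmem
      rw [Set.indicator_of_notMem hmem, h1] at hω
      exact zero_ne_one hω
    · refine Or.inl (measure_eq_zero_iff_ae_notMem.2 ?_)
      filter_upwards [hc] with ω hω hmem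
      rw [Set.indicator_of_mem hmem] at hω
      exact h1 hω.symm
  obtain ⟨b, hb⟩ := IsZeroOneMeasure.exists_eq_dirac (μ := P.map (L r))
  refine ⟨b, ?_⟩
  have : ∀ᵐ x ∂P.map (L r), x = b := by
    rw [hb, ae_dirac_eq]
    exact rfl
  exact ae_of_ae_map (hL.measurable r).aemeasurable this

/-- `L (r + r) - L r` has the law of `L r`, hence is a.s. the same constant. -/
theorem exists_ae_eq_two_mul {r : ℝ≥0} (h : ∃ b : B, ∀ᵐ ω ∂P, L r ω = b) :
    ∃ b : B, ∀ᵐ ω ∂P, L (r + r) ω = b := by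
  obtain ⟨b, hb⟩ := h
  refine ⟨b + b, ?_⟩
  have h1 : ∀ᵐ ω ∂P, L (r + r) ω - L r ω = b :=
    (hL.stationary r r).symm.ae_snd (p := fun x => x = b) (measurableSet_singleton b) hb
  filter_upwards [h1, hb] with ω h2 h3
  rw [sub_eq_iff_eq_add.1 h2, h3]

theorem isDeterministicProcess_of_le {r : ℝ≥0} (hr : 0 < r)
    (h : ∀ t ≤ r, ∃ b : B, ∀ᵐ ω ∂P, L t ω = b) : IsDeterministicProcess L P := by
  have key : ∀ n : ℕ, ∀ t ≤ 2 ^ n * r, ∃ b : B, ∀ᵐ ω ∂P, L t ω = b := by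
    intro n
    induction n with
    | zero => simpa using h
    | succ n ih =>
      intro t ht
      have h1 : t / 2 ≤ 2 ^ n * r := by
        rw [div_le_iff₀ two_pos]
        calc t ≤ 2 ^ (n + 1) * r := ht
          _ = 2 ^ n * r * 2 := by ring
      have h2 := hL.exists_ae_eq_two_mul (ih _ h1)
      rwa [add_halves] at h2
  intro t
  obtain ⟨n, hn⟩ := pow_unbounded_of_one_lt (t / r) (one_lt_two (α := ℝ≥0))
  exact key n t ((div_le_iff₀ hr).1 hn.le)

include hgen

theorem finrank_sq_le (r : PosTime) [FiniteDimensional ℂ (levyFibre L P (r + r))] :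
    Module.finrank ℂ (levyFibre L P r) * Module.finrank ℂ (levyFibre L P r) ≤
      Module.finrank ℂ (levyFibre L P (r + r)) := by
  obtain ⟨U, -⟩ := hL.exists_levyMultiplication hgen
  exact finrank_mul_finrank_le_of_hilbertTensor (U r r)

/-- If the dimension at `t` is at least `2`, the dimension at `t / 2` is strictly smaller, because
its square is at most the dimension at `t`. Halving repeatedly ends at dimension at most one. -/
theorem exists_finrank_le_one (d : ℕ) : ∀ t : PosTime, FiniteDimensional ℂ (levyFibre L P t) →
    Module.finrank ℂ (levyFibre L P t) ≤ d → ∃ r : PosTime,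
      FiniteDimensional ℂ (levyFibre L P r) ∧ Module.finrank ℂ (levyFibre L P r) ≤ 1 := by
  induction d with
  | zero => exact fun t ht h => ⟨t, ht, h.trans zero_le_one⟩
  | succ d ih =>
    intro t ht h
    by_cases h1 : Module.finrank ℂ (levyFibre L P t) ≤ 1
    · exact ⟨t, ht, h1⟩
    let r : PosTime := ⟨(t : ℝ≥0) / 2, half_pos t.2⟩
    have hrt : r + r = t := Subtype.ext (add_halves _)
    have hfr : FiniteDimensional ℂ (levyFibre L P r) :=
      Submodule.finiteDimensional_of_le (L2Sub_sigmaPast_mono (half_le_self zero_le))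
    have hsq : Module.finrank ℂ (levyFibre L P r) * Module.finrank ℂ (levyFibre L P r) ≤
        Module.finrank ℂ (levyFibre L P t) := by
      rw [← hrt] at ht ⊢
      exact hL.finrank_sq_le hgen r
    refine ih r hfr ?_
    by_contra! hlt
    nlinarith

theorem isDeterministicProcess_of_finiteDimensional {t : PosTime}
    (h : FiniteDimensional ℂ (levyFibre L P t)) : IsDeterministicProcess L P := by
  obtain ⟨r, hr, hr1⟩ := hL.exists_finrank_le_one hgen _ t h le_rfl
  refine hL.isDeterministicProcess_of_le r.2 fun u hu => ?_
  have hle : L2Sub P (sigmaPast L P u) ≤ L2Sub P (sigmaPast L P r) := L2Sub_sigmaPast_mono hu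
  have : FiniteDimensional ℂ (L2Sub P (sigmaPast L P u)) := Submodule.finiteDimensional_of_le hle
  exact hL.exists_ae_eq_of_finrank_le_one ((Submodule.finrank_mono hle).trans hr1)

theorem isProductSystem (hdet : ¬ IsDeterministicProcess L P) {U : ∀ s t : PosTime,
    HilbertTensor (levyFibre L P s) (levyFibre L P t) ≃ₗᵢ[ℂ] levyFibre L P (s + t)}
    (hU : ∀ s t f g, (U s t (pureTensor f g) : Lp ℂ 2 P) = hL.mulShift hgen s f g) :
    IsProductSystem U := by
  have hinf : ∀ t : PosTime, ¬ FiniteDimensional ℂ (levyFibre L P t) := fun t h =>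
    hdet (hL.isDeterministicProcess_of_finiteDimensional hgen h)
  refine { hL.isMultiplicativeBundle hgen hU with infinite_dim := hinf, trivializable := ?_ }
  have := hL.secondCountableTopology_L2 hgen
  have := hL.completeSpace_levyFibre
  have := hL.standardBorelSpace_totalSpace hgen
  have := secondCountableTopology_ell2
  obtain ⟨V, hV⟩ := (hL.isMeasurableFamily_levyFibre hgen).exists_trivialization hinf
  have hm : Measurable fun x : TotalSpace (levyFibre L P) => (x.time, V x.time x.vec) :=
    measurable_time.prodMk (hV _ _ _ (fun x => x.vec) measurable_time measurable_vec)
  have hinj : Function.Injective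
      fun x : TotalSpace (levyFibre L P) => (x.time, V x.time x.vec) := by
    rintro ⟨t, x⟩ ⟨s, y⟩ hxy
    obtain rfl : t = s := congrArg Prod.fst hxy
    exact congrArg _ ((V t).injective (congrArg Prod.snd hxy))
  have hsurj : Function.Surjective
      fun x : TotalSpace (levyFibre L P) => (x.time, V x.time x.vec) := fun q =>
    ⟨⟨q.1, (V q.1).symm q.2⟩, Prod.ext rfl ((V q.1).apply_symm_apply q.2)⟩
  -- The trivialization is a Borel bijection of standard Borel spaces, so its inverse is Borel as
  -- well.
  have he := hm.measurableEmbedding hinj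
  refine ⟨V, ⟨Equiv.ofBijective _ ⟨hinj, hsurj⟩, hm, ?_⟩, fun x => rfl⟩
  intro s hs
  rw [← Equiv.image_eq_preimage_symm]
  exact he.measurableSet_image.2 hs

end IsLevyProcess

theorem mainTheorem2 {Ω B : Type*} [mΩ : MeasurableSpace Ω] [NormedAddCommGroup B]
    [NormedSpace ℝ B] [CompleteSpace B] [TopologicalSpace.SeparableSpace B]
    [MeasurableSpace B] [BorelSpace B] (P : Measure Ω) [IsProbabilityMeasure P]
    (L : ℝ≥0 → Ω → B) (hL : IsLevyProcess L P) (hgen : mΩ = sigmaAll L) :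
    ∃ S : ShiftFamily L P,
      -- the shift of cylindrical functions extends uniquely to unitaries
      (IsShiftFamily L P S ∧ ∀ S', IsShiftFamily L P S' → S' = S) ∧
      -- these are composition with the shift of the sample space, where there is one
      (∀ (s : ℝ≥0) (σ : Ω → Ω), MeasurePreserving σ P P →
        (∀ t, ∀ᵐ ω ∂P, L t (σ ω) = L (s + t) ω - L s ω) →
        ∀ (t : ℝ≥0) (g : L2Sub P (sigmaPast L P t)),
          ((S s t g : Lp ℂ 2 P) : Ω → ℂ) =ᵐ[P] fun ω => ((g : Lp ℂ 2 P) : Ω → ℂ) (σ ω)) ∧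
      -- the multiplication is a well-defined family of unitaries
      ∃ U : ∀ s t : PosTime,
          HilbertTensor (levyFibre L P s) (levyFibre L P t) ≃ₗᵢ[ℂ] levyFibre L P (s + t),
        (IsLevyMultiplication L P S U ∧ ∀ U', IsLevyMultiplication L P S U' → U' = U) ∧
        IsMultiplicativeBundle U ∧
        (∀ φ : StrongDual ℝ B, ∃ u : ∀ t : PosTime, levyFibre L P t,
          (∀ t : PosTime, ((u t : Lp ℂ 2 P) : Ω → ℂ) =ᵐ[P]
            fun ω => Complex.exp (Complex.I * ((φ (L t ω) : ℝ) : ℂ))) ∧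
          IsProductUnit U u) ∧
        (¬ IsDeterministicProcess L P → IsSpatialProductSystem U) := by
  have : SecondCountableTopology B := UniformSpace.secondCountable_of_separable B
  obtain ⟨U, hU⟩ := hL.exists_levyMultiplication hgen
  refine ⟨hL.shiftFamily hgen, ⟨hL.isShiftFamily_shiftFamily hgen,
    fun S' hS' => hL.eq_of_isShiftFamily (hL.isShiftFamily_shiftFamily hgen) hS'⟩,
    fun s σ hσ hLσ t g => hL.shift_ae_eq_comp hgen s hσ hLσ g, U,
    ⟨(hL.isLevyMultiplication_iff hgen).2 hU, fun U' hU' => ?_⟩,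
    hL.isMultiplicativeBundle hgen hU, fun φ => ⟨_, fun t => hL.expL2_ae_eq φ t,
      hL.isProductUnit_expL2 hgen φ hU⟩,
    fun hdet => { hL.isProductSystem hgen hdet hU with
      -- The functional `0` gives the unit of constant functions `1`.
      exists_unit := ⟨_, hL.isProductUnit_expL2 hgen 0 hU⟩ }⟩
  have hU'' := (hL.isLevyMultiplication_iff hgen).1 hU'
  funext s t
  exact hilbertTensor_equiv_ext fun f g => Subtype.ext ((hU'' s t f g).trans (hU s t f g).symm)
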